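/- **Theorem.** Write $x=(\omega_1,\omega_2,\omega_3)\in\mathbf H^3=\mathbf R^{12}$, where the $\omega_i\in\mathbf H$ are Hamilton quaternions, and let $$w(x)=\frac{\operatorname{Re}(\omega_1\omega_2\omega_3)}{|x|}\quad(x\neq 0),\qquad w(0)=0 .$$ Then $w$ is homogeneous of order $2$, that is, $w(tx)=t^2w(x)$ for all $t>0$ and $x\in\mathbf R^{12}$. Moreover, let $Q$ be the space of real symmetric $12\times 12$ matrices. There are a $C^\infty$ function $F:Q\to\mathbf R$ and a constant $1\le\Lambda<10^8$ such that $F$ is uniformly elliptic with ellipticity constant $\Lambda$, i.e. $$\Lambda^{-1}|\xi|^2\le\sum_{i,j}F_{u_{ij}}(A)\,\xi_i\xi_j\le\Lambda|\xi|^2\qquad\text{for all }A\in Q,\ \xi\in\mathbf R^{12},$$ where $\sum_{i,j}F_{u_{ij}}(A)\xi_i\xi_j$ denotes the derivative of $F$ at $A$ in the direction $(\xi_i\xi_j)_{i,j}$, and such that $w$ is a viscosity solution of $F(D^2u)=0$ on all of $\mathbf R^{12}$, in both of the following usual senses. 1. (Test functions.) $w$ is continuous; if $\varphi$ is $C^2$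 near a point $x_0$ and $w-\varphi$ has a local maximum (resp. minimum) at $x_0$, then $F(D^2\varphi(x_0))\ge 0$ (resp. $\le 0$). 2. (Maximum principle.) $w$ is continuous; for every bounded domain $G\subset\mathbf R^{12}$ and every $v\in C^2(G)\cap C(\overline G)$: if $F(D^2v)\ge 0$ in $G$ and $v\le w$ on $\partial G$, then $v\le w$ in $G$; and if $F(D^2v)\le 0$ in $G$ and $v\ge w$ on $\partial G$, then $v\ge w$ in $G$. -/

import Mathlib

open scoped ContDiff

section General

variable {n : ℕ}

/-- The space `Q` of quadratic forms on `ℝⁿ`, as the space of symmetric `n × n` matrices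
`A = (A (i, j))` with the inner product `trace (A B) = ∑ A (i, j) * B (i, j)`. -/
def SymMat (n : ℕ) : Submodule ℝ (EuclideanSpace ℝ (Fin n × Fin n)) where
  carrier := {A | ∀ i j, A (i, j) = A (j, i)}
  zero_mem' := by intro i j; simp
  add_mem' := by
    intro A B hA hB i j
    simp only [PiLp.add_apply, hA i j, hB i j]
  smul_mem' := by
    intro c A hA i j
    simp only [PiLp.smul_apply, hA i j]

/-- The symmetric matrix `(ξ_i ξ_j)`. -/
noncomputable def rankOne (ξ : EuclideanSpace ℝ (Fin n)) : SymMat n :=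
  ⟨WithLp.toLp 2 fun p => ξ p.1 * ξ p.2, fun _ _ => mul_comm _ _⟩

/-- The second partial derivative `∂²u/∂x_i∂x_j` at `x`. -/
noncomputable def secondPartial (u : EuclideanSpace ℝ (Fin n) → ℝ) (x : EuclideanSpace ℝ (Fin n))
    (i j : Fin n) : ℝ :=
  fderiv ℝ (fderiv ℝ u) x (EuclideanSpace.single i 1) (EuclideanSpace.single j 1)

/-- The Hessian `D²u(x)`. Symmetrizing makes it an element of `SymMat n` for every function;
where `u` is `C²` its entries are the second partial derivatives, see `hessian_apply`. -/
noncomputable def hessian (u : EuclideanSpace ℝ (Fin n) → ℝ) (x : EuclideanSpace ℝ (Fin n)) :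
    SymMat n :=
  ⟨WithLp.toLp 2 fun p => (secondPartial u x p.1 p.2 + secondPartial u x p.2 p.1) / 2,
    fun i j => by simp only [add_comm]⟩

theorem hessian_apply {u : EuclideanSpace ℝ (Fin n) → ℝ} {x : EuclideanSpace ℝ (Fin n)}
    (hu : ContDiffAt ℝ 2 u x) (i j : Fin n) :
    (hessian u x : EuclideanSpace ℝ (Fin n × Fin n)) (i, j) = secondPartial u x i j := by
  have hs : IsSymmSndFDerivAt ℝ u x := hu.isSymmSndFDerivAt (by simp)
  have h : secondPartial u x j i = secondPartial u x i j := hs _ _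
  simp only [hessian, h]
  ring

/-- `F` is uniformly elliptic with ellipticity constant `Λ ≥ 1`:
`Λ⁻¹ |ξ|² ≤ F_{u_ij} ξ_i ξ_j ≤ Λ |ξ|²` at every symmetric matrix, for every `ξ`. Here
`F_{u_ij} ξ_i ξ_j` is the derivative of `F` in the direction of the symmetric matrix `(ξ_i ξ_j)`. -/
def IsUniformlyElliptic (F : SymMat n → ℝ) (Λ : ℝ) : Prop :=
  1 ≤ Λ ∧ Differentiable ℝ F ∧ ∀ (A : SymMat n) (ξ : EuclideanSpace ℝ (Fin n)),
    Λ⁻¹ * ‖ξ‖ ^ 2 ≤ fderiv ℝ F A (rankOne ξ) ∧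
      fderiv ℝ F A (rankOne ξ) ≤ Λ * ‖ξ‖ ^ 2

/-- `u` is a viscosity solution of `F(D²u) = 0` in the open set `Ω`, by test functions: `u` is
continuous, `F(D²φ(x)) ≥ 0` whenever a `C²` function `φ` touches `u` from above at `x ∈ Ω`, and
`F(D²φ(x)) ≤ 0` whenever a `C²` function `φ` touches `u` from below at `x ∈ Ω`. -/
def IsViscositySolution (F : SymMat n → ℝ) (Ω : Set (EuclideanSpace ℝ (Fin n)))
    (u : EuclideanSpace ℝ (Fin n) → ℝ) : Prop :=
  ContinuousOn u Ω ∧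
  (∀ x ∈ Ω, ∀ φ : EuclideanSpace ℝ (Fin n) → ℝ, ContDiffAt ℝ 2 φ x →
    IsLocalMax (fun y => u y - φ y) x →
    0 ≤ F (hessian φ x)) ∧
  (∀ x ∈ Ω, ∀ φ : EuclideanSpace ℝ (Fin n) → ℝ, ContDiffAt ℝ 2 φ x →
    IsLocalMin (fun y => u y - φ y) x →
    F (hessian φ x) ≤ 0)

/-- The comparison form of the notion: `u` is continuous in `Ω`, and the maximum principle for
`F(D²u) = 0` holds between `u` and every `C²` function `v`, on all bounded subdomains `G` with
closure in `Ω` (`v` is `C²` in `G` and continuous up to the boundary). -/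
def SatisfiesMaximumPrinciple (F : SymMat n → ℝ) (Ω : Set (EuclideanSpace ℝ (Fin n)))
    (u : EuclideanSpace ℝ (Fin n) → ℝ) : Prop :=
  ContinuousOn u Ω ∧
  ∀ G : Set (EuclideanSpace ℝ (Fin n)), IsOpen G → IsConnected G → Bornology.IsBounded G →
    closure G ⊆ Ω →
    ∀ v : EuclideanSpace ℝ (Fin n) → ℝ, ContinuousOn v (closure G) → ContDiffOn ℝ 2 v G →
      (((∀ x ∈ G, 0 ≤ F (hessian v x)) → (∀ x ∈ frontier G, v x ≤ u x) → ∀ x ∈ G, v x ≤ u x) ∧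
      ((∀ x ∈ G, F (hessian v x) ≤ 0) → (∀ x ∈ frontier G, u x ≤ v x) → ∀ x ∈ G, u x ≤ v x))

end General

/-- `w(x) = Re(ω₁ ω₂ ω₃) / |x|`, where `x = (ω₁, ω₂, ω₃) ∈ ℍ³ = ℝ¹²`; its value at `x = 0` is
`0 / 0 = 0`. -/
noncomputable def quaternionicW (x : EuclideanSpace ℝ (Fin 12)) : ℝ :=
  let ω₁ : Quaternion ℝ := ⟨x 0, x 1, x 2, x 3⟩
  let ω₂ : Quaternion ℝ := ⟨x 4, x 5, x 6, x 7⟩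
  let ω₃ : Quaternion ℝ := ⟨x 8, x 9, x 10, x 11⟩
  (ω₁ * ω₂ * ω₃).re / ‖x‖

open Topology Filter
open scoped Manifold

/-! Write `P` for the cubic form `Re (ω₁ ω₂ ω₃)` and `T x = D²w(x)`, which is constant on rays and
smooth off the origin. The equation is built from one fact: the sublinear elliptic operator `p A =
tr A + κ max_{|ξ| ≤ 1} A ξ · ξ` separates Hessians, `|a - b| ≤ p (T a - T b)` on the unit sphere
(`norm_sub_le_extremal`).

Separation. Put `d = a - b`. On directions `h` orthogonal to `a` and `b`, `T a - T b` is
`D²P(d)(h,h) - (P(a) - P(b)) |h|²`, while its trace is `-15 (P(a) - P(b))`. Let `δ = max |dᵢ|`.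
Always `P(a) - P(b) ≤ δ`, and `D²P(d)` takes the value `δ |h|²` on a four-dimensional space, which
meets the two orthogonality conditions nontrivially. This suffices unless `P(a) - P(b)` is almost
`δ`. In that case (`chord_dichotomy`) the quaternions are so aligned that `Re (d₁ d₂ d₃)` is close
to `-|d₁| |d₂| |d₃|`, and a three-dimensional space with a value near `2 δ |h|²` takes over. A large
`κ` then absorbs the trace.

Equation. The function `f A = inf_{|z| = 1} p (A - T z)` inherits the ellipticity of `p` and
vanishes on the Hessians of `w`, but is only Lipschitz. Its mollification `g` is smooth and equally
elliptic, but no longer vanishes there. Since `f` vanishes on the image of `T` and near-minimisers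
of `f (T x + E)` lie close to `x`, `g ∘ T` is of size `O(ε)` together with its gradient. With `R` a
smooth left inverse of `T` on the sphere and `χ` a cutoff, `F = g - χ · (g ∘ T ∘ R)` vanishes
exactly on the Hessians, and for small `ε` the correction does not spoil ellipticity
(`exists_smooth_vanishing`).

Viscosity. Away from `0` the equation holds classically. At `0`, homogeneity lets a test function be
replaced by a quadratic form that touches `w` at a point of the sphere
(`subsolution_of_homogeneous`). The maximum principle follows by a quadratic perturbation. -/

/-! ### Quaternion estimates: chords on which `P(a) - P(b)` is nearly maximal. -/

theorem abs_re_le_norm (q : Quaternion ℝ) : |q.re| ≤ ‖q‖ := by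
  apply abs_le_of_sq_le_sq _ (norm_nonneg q)
  rw [sq ‖q‖, ← Quaternion.normSq_eq_norm_mul_self, Quaternion.normSq_def']
  nlinarith [sq_nonneg q.imI, sq_nonneg q.imJ, sq_nonneg q.imK]

theorem re_mul_rotate (a b c : Quaternion ℝ) : (a * b * c).re = (b * c * a).re := by
  simp only [Quaternion.re_mul, Quaternion.imI_mul, Quaternion.imJ_mul, Quaternion.imK_mul]
  ring

theorem norm_sub_star_sq (e y : Quaternion ℝ) :
    ‖e - star y‖ ^ 2 = ‖e‖ ^ 2 + ‖y‖ ^ 2 - 2 * (e * y).re := by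
  rw [norm_sub_sq_real, Quaternion.inner_def, star_star, _root_.norm_star]; ring

/-- Here `δᵢ = |dᵢ|` and `μᵢ = |mᵢ|` for the difference `d` and midpoint `m` of two unit vectors,
and the `r`'s are real parts of triple products. Multiplying the normalisation `hn` by `δ₃` exhibits
the deficit as a sum of terms that are nonnegative when `δ₃` is the largest `δᵢ`, so a small deficit
makes each of them small. -/
theorem deficit_bounds {δ₁ δ₂ δ₃ μ₁ μ₂ μ₃ r₁ r₂ r₃ r₀ : ℝ} (h3 : 0 ≤ δ₃)
    (hn : μ₁ ^ 2 + μ₂ ^ 2 + μ₃ ^ 2 + (δ₁ ^ 2 + δ₂ ^ 2 + δ₃ ^ 2) / 4 = 1)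
    (hr₀ : r₀ ≤ δ₁ * (δ₂ * δ₃)) :
    δ₃ * (((μ₁ - μ₂) ^ 2 + (μ₂ - μ₃) ^ 2 + (μ₃ - μ₁) ^ 2) / 2
      + (δ₁ ^ 2 + δ₂ ^ 2 + δ₃ ^ 2) / 8) + (δ₃ - δ₁) * (μ₂ * μ₃) + (δ₃ - δ₂) * (μ₃ * μ₁)
      + (δ₁ * (μ₂ * μ₃) - r₁) + (δ₂ * (μ₃ * μ₁) - r₂) + (δ₃ * (μ₁ * μ₂) - r₃)
      ≤ δ₃ - (r₁ + r₂ + r₃ + r₀ / 4) := by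
  have hk : δ₁ * (δ₂ * δ₃) ≤ δ₃ * ((δ₁ ^ 2 + δ₂ ^ 2 + δ₃ ^ 2) / 2) := by
    have : δ₁ * δ₂ ≤ (δ₁ ^ 2 + δ₂ ^ 2 + δ₃ ^ 2) / 2 := by
      nlinarith [sq_nonneg (δ₁ - δ₂), sq_nonneg δ₃]
    calc δ₁ * (δ₂ * δ₃) = δ₃ * (δ₁ * δ₂) := by ring
      _ ≤ _ := mul_le_mul_of_nonneg_left this h3
  have e : δ₃ = δ₃ * (μ₁ ^ 2 + μ₂ ^ 2 + μ₃ ^ 2 + (δ₁ ^ 2 + δ₂ ^ 2 + δ₃ ^ 2) / 4) := by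
    rw [hn, mul_one]
  nlinarith

/-- The real part of a product of three unit quaternions that nearly maximise three coupled
trilinear expressions, subject to an orthogonality relation. -/
theorem re_mul_mul_le_of_near {e₁ e₂ e₃ u₁ u₂ u₃ : Quaternion ℝ} {s₁ s₂ s₃ : ℝ}
    (he₁ : ‖e₁‖ = 1) (he₂ : ‖e₂‖ = 1) (hu₁ : ‖u₁‖ = 1) (hu₂ : ‖u₂‖ = 1) (hu₃ : ‖u₃‖ = 1)
    (hs₁ : 0 < s₁) (hs₂ : 0 < s₂) (hs₃ : 0 < s₃)
    (ho : s₁ * (u₁ * star e₁).re + s₂ * (u₂ * star e₂).re + s₃ * (u₃ * star e₃).re = 0)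
    (h₁ : ‖e₁ - star (u₂ * u₃)‖ ≤ 3 / 100) (h₂ : ‖e₂ - star (u₃ * u₁)‖ ≤ 3 / 100)
    (h₃ : ‖e₃ - star (u₁ * u₂)‖ ≤ 3 / 100) : (e₁ * e₂ * e₃).re ≤ -(9 / 10) := by
  have habs := abs_re_le_norm
  set p := u₁ * u₂ * u₃ with hp
  have c : ∀ x e y : Quaternion ℝ, ‖x‖ = 1 → ‖e - star y‖ ≤ 3 / 100 →
      |(x * star e).re - (x * y).re| ≤ 3 / 100 := by
    intro x e y hx h
    have : (x * star e).re - (x * y).re = (x * star (e - star y)).re := by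
      rw [star_sub, star_star, mul_sub, Quaternion.re_sub]
    rw [this]
    refine (habs _).trans ?_
    rw [norm_mul, hx, _root_.norm_star, one_mul]; exact h
  have c1 := abs_le.1 (c u₁ e₁ _ hu₁ h₁)
  have c2 := abs_le.1 (c u₂ e₂ _ hu₂ h₂)
  have c3 := abs_le.1 (c u₃ e₃ _ hu₃ h₃)
  have r1 : (u₁ * (u₂ * u₃)).re = p.re := by rw [hp, mul_assoc]
  have r2 : (u₂ * (u₃ * u₁)).re = p.re := by
    simp only [hp, Quaternion.re_mul, Quaternion.imI_mul, Quaternion.imJ_mul, Quaternion.imK_mul]; ring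
  have r3 : (u₃ * (u₁ * u₂)).re = p.re := by
    simp only [hp, Quaternion.re_mul, Quaternion.imI_mul, Quaternion.imJ_mul, Quaternion.imK_mul]; ring
  rw [r1] at c1; rw [r2] at c2; rw [r3] at c3
  -- Each `Re (uᵢ ēᵢ)` is within `3 / 100` of `Re p`. Were `|Re p|` larger, all three would have one
  -- strict sign, against the weighted sum `ho` being zero.
  have hpr : |p.re| ≤ 3 / 100 := by
    rw [abs_le]
    constructor
    · by_contra hc
      nlinarith [mul_pos hs₁ (show 0 < -(u₁ * star e₁).re by linarith), mul_pos hs₂ (show 0 < -(u₂ * star e₂).re by linarith), mul_pos hs₃ (show 0 < -(u₃ * star e₃).re by linarith)]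
    · by_contra hc
      nlinarith [mul_pos hs₁ (show 0 < (u₁ * star e₁).re by linarith), mul_pos hs₂ (show 0 < (u₂ * star e₂).re by linarith), mul_pos hs₃ (show 0 < (u₃ * star e₃).re by linarith)]
  have hpn : ‖p‖ = 1 := by rw [hp, norm_mul, norm_mul, hu₁, hu₂, hu₃]; norm_num
  -- So `e₁ e₂ e₃` is nearly the square of the unit quaternion `star p`, whose real part is nearly
  -- zero; such a square is nearly `-1`.
  have hU : star (u₂ * u₃) * star (u₃ * u₁) * star (u₁ * u₂) = star p * star p := by
    simp only [hp, star_mul, mul_assoc]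
  have hdiff : ‖e₁ * e₂ * e₃ - star p * star p‖ ≤ 9 / 100 := by
    rw [← hU]
    have : e₁ * e₂ * e₃ - star (u₂ * u₃) * star (u₃ * u₁) * star (u₁ * u₂)
        = e₁ * e₂ * (e₃ - star (u₁ * u₂)) + e₁ * (e₂ - star (u₃ * u₁)) * star (u₁ * u₂)
          + (e₁ - star (u₂ * u₃)) * star (u₃ * u₁) * star (u₁ * u₂) := by noncomm_ring
    rw [this]
    refine (norm_add₃_le).trans ?_
    simp only [norm_mul, he₁, he₂, one_mul]
    have hss : ‖star (u₁ * u₂)‖ = 1 ∧ ‖star (u₃ * u₁)‖ = 1 := by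
      simp only [_root_.norm_star, norm_mul, hu₁, hu₂, hu₃, mul_one, and_self]
    rw [hss.1, hss.2]
    linarith
  have hsq : (star p * star p).re = 2 * p.re ^ 2 - 1 := by
    have h := Quaternion.normSq_eq_norm_mul_self p
    rw [hpn, Quaternion.normSq_def'] at h
    simp only [Quaternion.re_mul, Quaternion.re_star, Quaternion.imI_star, Quaternion.imJ_star, Quaternion.imK_star]
    linarith
  have := abs_le.1 ((habs _).trans hdiff)
  rw [Quaternion.re_sub, hsq] at this
  nlinarith [abs_le.1 hpr, sq_abs p.re, abs_nonneg p.re]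

theorem abs_re_mul_mul_le (a b c : Quaternion ℝ) : |(a * b * c).re| ≤ ‖a‖ * (‖b‖ * ‖c‖) := by
  refine (abs_re_le_norm _).trans ?_
  rw [norm_mul, norm_mul, mul_assoc]

theorem norm_unit_sub_star_le {d m n : Quaternion ℝ} {k : ℝ} (hd : 0 < ‖d‖) (hm : 0 < ‖m‖)
    (hn : 0 < ‖n‖) (h : ‖d‖ * (‖m‖ * ‖n‖) - (d * m * n).re ≤ k * (‖d‖ * (‖m‖ * ‖n‖))) :
    ‖(‖d‖⁻¹ : ℝ) • d - star (((‖m‖⁻¹ : ℝ) • m) * ((‖n‖⁻¹ : ℝ) • n))‖ ^ 2 ≤ 2 * k := by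
  have hc : 0 < ‖d‖ * (‖m‖ * ‖n‖) := by positivity
  rw [norm_sub_star_sq]
  have e : ((‖d‖⁻¹ : ℝ) • d) * (((‖m‖⁻¹ : ℝ) • m) * ((‖n‖⁻¹ : ℝ) • n))
      = ((‖d‖ * (‖m‖ * ‖n‖))⁻¹ : ℝ) • (d * m * n) := by
    simp only [smul_mul_assoc, mul_smul_comm, smul_smul, mul_assoc, mul_inv]
    congr 1; ring
  rw [e, Quaternion.re_smul, smul_eq_mul, norm_mul]
  simp only [norm_smul, norm_inv, norm_norm, inv_mul_cancel₀ hd.ne', inv_mul_cancel₀ hm.ne',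
    inv_mul_cancel₀ hn.ne']
  have : 1 - k ≤ (‖d‖ * (‖m‖ * ‖n‖))⁻¹ * (d * m * n).re := by
    rw [inv_mul_eq_div, le_div_iff₀ hc]; linarith
  linarith

theorem half_le_of_sum_sq {a b c : ℝ} (ha : 0 ≤ a) (hb : 0 ≤ b) (hc : 0 ≤ c)
    (h1 : b - a ≤ 15 / 1000) (h2 : c - a ≤ 15 / 1000) (h : 99 / 100 ≤ a ^ 2 + b ^ 2 + c ^ 2) :
    1 / 2 ≤ a := by
  by_contra hlt
  have hb' : b ^ 2 ≤ (515 / 1000) ^ 2 := pow_le_pow_left₀ hb (by linarith) 2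
  have hc' : c ^ 2 ≤ (515 / 1000) ^ 2 := pow_le_pow_left₀ hc (by linarith) 2
  have ha' : a ^ 2 ≤ (1 / 2) ^ 2 := pow_le_pow_left₀ ha (by linarith) 2
  linarith

theorem near_extremal_bounds {δ₁ δ₂ δ₃ μ₁ μ₂ μ₃ r₁ r₂ r₃ r₀ : ℝ} (h1 : 0 ≤ δ₁) (h2 : 0 ≤ δ₂)
    (h3 : 0 < δ₃) (h13 : δ₁ ≤ δ₃) (h23 : δ₂ ≤ δ₃) (m1 : 0 ≤ μ₁) (m2 : 0 ≤ μ₂) (m3 : 0 ≤ μ₃)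
    (hn : μ₁ ^ 2 + μ₂ ^ 2 + μ₃ ^ 2 + (δ₁ ^ 2 + δ₂ ^ 2 + δ₃ ^ 2) / 4 = 1)
    (hr₁ : r₁ ≤ δ₁ * (μ₂ * μ₃)) (hr₂ : r₂ ≤ δ₂ * (μ₃ * μ₁)) (hr₃ : r₃ ≤ δ₃ * (μ₁ * μ₂))
    (hr₀ : r₀ ≤ δ₁ * (δ₂ * δ₃)) :
    r₁ + r₂ + r₃ + r₀ / 4 ≤ δ₃ ∧
    (δ₃ - (r₁ + r₂ + r₃ + r₀ / 4) ≤ δ₃ * (1 / 10 ^ 4) →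
      (1 / 2 ≤ μ₁ ∧ 1 / 2 ≤ μ₂ ∧ 1 / 2 ≤ μ₃) ∧ (99 / 100 * δ₃ ≤ δ₁ ∧ 99 / 100 * δ₃ ≤ δ₂) ∧
      δ₁ * (μ₂ * μ₃) - r₁ ≤ 42 / 10 ^ 5 * (δ₁ * (μ₂ * μ₃)) ∧
      δ₂ * (μ₃ * μ₁) - r₂ ≤ 42 / 10 ^ 5 * (δ₂ * (μ₃ * μ₁)) ∧
      δ₃ * (μ₁ * μ₂) - r₃ ≤ 42 / 10 ^ 5 * (δ₃ * (μ₁ * μ₂))) := by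
  have D := deficit_bounds (r₁ := r₁) (r₂ := r₂) (r₃ := r₃) h3.le hn hr₀
  have t1 : 0 ≤ δ₃ * (((μ₁ - μ₂) ^ 2 + (μ₂ - μ₃) ^ 2 + (μ₃ - μ₁) ^ 2) / 2
      + (δ₁ ^ 2 + δ₂ ^ 2 + δ₃ ^ 2) / 8) := by positivity
  have t2 : 0 ≤ (δ₃ - δ₁) * (μ₂ * μ₃) := mul_nonneg (by linarith) (by positivity)
  have t3 : 0 ≤ (δ₃ - δ₂) * (μ₃ * μ₁) := mul_nonneg (by linarith) (by positivity)
  refine ⟨by linarith, fun hdef => ?_⟩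
  have q1 : ((μ₁ - μ₂) ^ 2 + (μ₂ - μ₃) ^ 2 + (μ₃ - μ₁) ^ 2) / 2
      + (δ₁ ^ 2 + δ₂ ^ 2 + δ₃ ^ 2) / 8 ≤ 1 / 10 ^ 4 :=
    le_of_mul_le_mul_left (by linarith) h3
  have s1 := sq_nonneg (μ₁ - μ₂)
  have s2 := sq_nonneg (μ₂ - μ₃)
  have s3 := sq_nonneg (μ₃ - μ₁)
  have s4 := sq_nonneg δ₁
  have s5 := sq_nonneg δ₂
  have s6 := sq_nonneg δ₃
  have b12 : |μ₁ - μ₂| ≤ 15 / 1000 := abs_le_of_sq_le_sq (by linarith) (by norm_num)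
  have b23 : |μ₂ - μ₃| ≤ 15 / 1000 := abs_le_of_sq_le_sq (by linarith) (by norm_num)
  have b31 : |μ₃ - μ₁| ≤ 15 / 1000 := abs_le_of_sq_le_sq (by linarith) (by norm_num)
  rw [abs_le] at b12 b23 b31
  have p1 : 1 / 2 ≤ μ₁ := half_le_of_sum_sq m1 m2 m3 (by linarith) (by linarith) (by linarith)
  have p2 : 1 / 2 ≤ μ₂ := half_le_of_sum_sq m2 m1 m3 (by linarith) (by linarith) (by linarith)
  have p3 : 1 / 2 ≤ μ₃ := half_le_of_sum_sq m3 m1 m2 (by linarith) (by linarith) (by linarith)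
  have p23 : 1 / 4 ≤ μ₂ * μ₃ := by nlinarith only [p2, p3]
  have p31 : 1 / 4 ≤ μ₃ * μ₁ := by nlinarith only [p3, p1]
  have p12 : 1 / 4 ≤ μ₁ * μ₂ := by nlinarith only [p1, p2]
  have g1 : 99 / 100 * δ₃ ≤ δ₁ := by
    have : (δ₃ - δ₁) * (1 / 4) ≤ (δ₃ - δ₁) * (μ₂ * μ₃) :=
      mul_le_mul_of_nonneg_left p23 (by linarith)
    linarith
  have g2 : 99 / 100 * δ₃ ≤ δ₂ := by
    have : (δ₃ - δ₂) * (1 / 4) ≤ (δ₃ - δ₂) * (μ₃ * μ₁) :=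
      mul_le_mul_of_nonneg_left p31 (by linarith)
    linarith
  -- Each product is at least `99 / 400 * δ₃`, so a deficit of `δ₃ / 10 ^ 4` is at most `42 / 10 ^
  -- 5` of it.
  have z1 := mul_le_mul g1 p23 (by norm_num) h1
  have z2 := mul_le_mul g2 p31 (by norm_num) h2
  have z3 := mul_le_mul_of_nonneg_left p12 h3.le
  exact ⟨⟨p1, p2, p3⟩, ⟨g1, g2⟩, by linarith, by linarith, by linarith⟩

/-- For `a = m + d / 2` and `b = m - d / 2` of norm one, `hn` and `ho` are the parallelogram
identity and `m ⟂ d`, and `μ = P(a) - P(b)`. If `μ` nearly attains its bound, each `dᵢ` is nearly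
parallel to the conjugate of the product of the other two `mⱼ`, and `re_mul_mul_le_of_near` applies
to the normalised quaternions. -/
theorem chord_dichotomy {d₁ d₂ d₃ m₁ m₂ m₃ : Quaternion ℝ} (h13 : ‖d₁‖ ≤ ‖d₃‖) (h23 : ‖d₂‖ ≤ ‖d₃‖)
    (h3 : 0 < ‖d₃‖)
    (hn : ‖m₁‖ ^ 2 + ‖m₂‖ ^ 2 + ‖m₃‖ ^ 2 + (‖d₁‖ ^ 2 + ‖d₂‖ ^ 2 + ‖d₃‖ ^ 2) / 4 = 1)
    (ho : (m₁ * star d₁).re + (m₂ * star d₂).re + (m₃ * star d₃).re = 0) {μ : ℝ}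
    (hμ : μ = (d₁ * m₂ * m₃).re + (m₁ * d₂ * m₃).re + (m₁ * m₂ * d₃).re
      + (d₁ * d₂ * d₃).re / 4) :
    μ ≤ ‖d₃‖ ∧ (μ ≤ ‖d₃‖ * (1 - 1 / 10 ^ 4) ∨ (0 < ‖d₁‖ ∧ 0 < ‖d₂‖ ∧
      (d₁ * d₂ * d₃).re ≤ -(9 / 10) * (‖d₁‖ * (‖d₂‖ * ‖d₃‖)) ∧ 99 / 100 * ‖d₃‖ ≤ ‖d₁‖ ∧
      99 / 100 * ‖d₃‖ ≤ ‖d₂‖)) := by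
  have hr₁ := (abs_le.1 (abs_re_mul_mul_le d₁ m₂ m₃)).2
  have hr₂ := (abs_le.1 (abs_re_mul_mul_le d₂ m₃ m₁)).2
  have hr₃ := (abs_le.1 (abs_re_mul_mul_le d₃ m₁ m₂)).2
  have hr₀ := (abs_le.1 (abs_re_mul_mul_le d₁ d₂ d₃)).2
  rw [re_mul_rotate m₁ d₂ m₃, ← re_mul_rotate d₃ m₁ m₂] at hμ
  obtain ⟨D, D'⟩ := near_extremal_bounds (norm_nonneg d₁) (norm_nonneg d₂) h3 h13 h23
    (norm_nonneg m₁) (norm_nonneg m₂) (norm_nonneg m₃) hn hr₁ hr₂ hr₃ hr₀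
  rw [← hμ] at D D'
  refine ⟨D, ?_⟩
  by_contra! hcon
  obtain ⟨hA, hB⟩ := hcon
  obtain ⟨⟨p1, p2, p3⟩, ⟨g1, g2⟩, w1, w2, w3⟩ := D' (by linarith)
  have hd1 : 0 < ‖d₁‖ := by linarith
  have hd2 : 0 < ‖d₂‖ := by linarith
  have hm1 : 0 < ‖m₁‖ := by linarith
  have hm2 : 0 < ‖m₂‖ := by linarith
  have hm3 : 0 < ‖m₃‖ := by linarith
  have key : ∀ {x : Quaternion ℝ}, ‖x‖ ^ 2 ≤ 2 * (42 / 10 ^ 5) → ‖x‖ ≤ 3 / 100 := fun h =>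
    abs_le_of_sq_le_sq' (h.trans (by norm_num)) (by norm_num) |>.2
  have v1 := key (norm_unit_sub_star_le hd1 hm2 hm3 w1)
  have v2 := key (norm_unit_sub_star_le hd2 hm3 hm1 w2)
  have v3 := key (norm_unit_sub_star_le h3 hm1 hm2 w3)
  have hu : ∀ {x : Quaternion ℝ}, 0 < ‖x‖ → ‖(‖x‖⁻¹ : ℝ) • x‖ = 1 := fun h => by
    rw [norm_smul, norm_inv, norm_norm, inv_mul_cancel₀ h.ne']
  have hw : ∀ {m d : Quaternion ℝ}, 0 < ‖m‖ → 0 < ‖d‖ →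
      ‖m‖ * ‖d‖ * (((‖m‖⁻¹ : ℝ) • m) * star ((‖d‖⁻¹ : ℝ) • d)).re = (m * star d).re := by
    intro m d hm hd
    rw [Quaternion.star_smul, smul_mul_smul_comm, Quaternion.re_smul, smul_eq_mul]
    field_simp
  have := re_mul_mul_le_of_near (hu hd1) (hu hd2) (hu hm1) (hu hm2) (hu hm3)
    (mul_pos hm1 hd1) (mul_pos hm2 hd2) (mul_pos hm3 h3)
    (by rw [hw hm1 hd1, hw hm2 hd2, hw hm3 h3]; exact ho) v1 v2 v3
  have hP : (d₁ * d₂ * d₃).re ≤ -(9 / 10) * (‖d₁‖ * (‖d₂‖ * ‖d₃‖)) := by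
    rw [smul_mul_smul_comm, smul_mul_smul_comm, Quaternion.re_smul, smul_eq_mul, ← mul_inv,
      ← mul_inv, inv_mul_eq_div, div_le_iff₀ (by positivity)] at this
    linarith
  exact absurd (hB hd1 hd2 hP g1) (not_lt.2 g2)

/-! ### Test directions orthogonal to both ends of a chord. -/

theorem exists_ne_zero_map_eq_zero {W : Type*} [AddCommGroup W] [Module ℝ W]
    [FiniteDimensional ℝ W] (hW : 2 < Module.finrank ℝ W) (l m : W →ₗ[ℝ] ℝ) :
    ∃ ν, ν ≠ 0 ∧ l ν = 0 ∧ m ν = 0 := by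
  have h := LinearMap.ker_ne_bot_of_finrank_lt (f := l.prod m)
    (by rw [Module.finrank_prod, Module.finrank_self]; exact hW)
  obtain ⟨ν, hν, h0⟩ := (Submodule.ne_bot_iff _).1 h
  rw [LinearMap.mem_ker, LinearMap.prod_apply, Prod.mk_eq_zero] at hν
  exact ⟨ν, h0, hν.1, hν.2⟩

theorem exists_orthogonal_triple {W : Type*} [AddCommGroup W] [Module ℝ W]
    [FiniteDimensional ℝ W] (hW : 2 < Module.finrank ℝ W) (f₁ f₂ f₃ : W →ₗ[ℝ] Quaternion ℝ)
    (a₁ a₂ a₃ b₁ b₂ b₃ : Quaternion ℝ) :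
    ∃ ν, ν ≠ 0 ∧
      (a₁ * star (f₁ ν)).re + (a₂ * star (f₂ ν)).re + (a₃ * star (f₃ ν)).re = 0 ∧
      (b₁ * star (f₁ ν)).re + (b₂ * star (f₂ ν)).re + (b₃ * star (f₃ ν)).re = 0 := by
  let l : Quaternion ℝ → Quaternion ℝ → Quaternion ℝ → W →ₗ[ℝ] ℝ := fun a₁ a₂ a₃ =>
    (innerₗ (Quaternion ℝ) a₁).comp f₁ + (innerₗ (Quaternion ℝ) a₂).comp f₂
      + (innerₗ (Quaternion ℝ) a₃).comp f₃
  exact exists_ne_zero_map_eq_zero hW (l a₁ a₂ a₃) (l b₁ b₂ b₃)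

/-- The imaginary quaternions, parametrized by `ℝ³`. -/
def imQuaternion : (Fin 3 → ℝ) →ₗ[ℝ] Quaternion ℝ where
  toFun v := ⟨0, v 0, v 1, v 2⟩
  map_add' _ _ := Quaternion.ext _ _ (add_zero 0).symm rfl rfl rfl
  map_smul' c _ := Quaternion.ext _ _ (mul_zero c).symm rfl rfl rfl

theorem imQuaternion_ne_zero {v : Fin 3 → ℝ} (hv : v ≠ 0) : imQuaternion v ≠ 0 := by
  intro h
  apply hv
  have h1 := congrArg QuaternionAlgebra.imI h
  have h2 := congrArg QuaternionAlgebra.imJ h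
  have h3 := congrArg QuaternionAlgebra.imK h
  funext i
  fin_cases i
  · exact h1
  · exact h2
  · exact h3

theorem imQuaternion_mul_self (v : Fin 3 → ℝ) :
    imQuaternion v * imQuaternion v = ((-‖imQuaternion v‖ ^ 2 : ℝ) : Quaternion ℝ) := by
  have h : star (imQuaternion v) = -imQuaternion v :=
    Quaternion.ext _ _ (by rw [Quaternion.re_star, Quaternion.re_neg]; exact neg_zero.symm)
      (Quaternion.imI_star _) (Quaternion.imJ_star _) (Quaternion.imK_star _)
  rw [← neg_neg (imQuaternion v * imQuaternion v), ← mul_neg, ← h, Quaternion.self_mul_star,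
    Quaternion.normSq_eq_norm_mul_self, ← Quaternion.coe_neg, sq, neg_mul_eq_neg_mul]

/-- The second derivative at `d` of `(x₁, x₂, x₃) ↦ Re (x₁ x₂ x₃)`, halved, as a quadratic form. -/
noncomputable def tripleForm (d₁ d₂ d₃ h₁ h₂ h₃ : Quaternion ℝ) : ℝ :=
  (d₁ * h₂ * h₃).re + (h₁ * d₂ * h₃).re + (h₁ * h₂ * d₃).re

theorem tripleForm_rotate (d₁ d₂ d₃ h₁ h₂ h₃ : Quaternion ℝ) :
    tripleForm d₂ d₃ d₁ h₂ h₃ h₁ = tripleForm d₁ d₂ d₃ h₁ h₂ h₃ := by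
  simp only [tripleForm]
  rw [re_mul_rotate d₁, re_mul_rotate h₁ d₂, re_mul_rotate h₁ h₂]
  ring

/-- With `h₁ = |d₃| ν`, `h₂ = star (d₃ ν)`, `h₃ = 0`, the product `h₁ h₂ d₃` is real and positive.
The free quaternion `ν` has four real parameters, two more than the orthogonality conditions use up.
-/
theorem exists_tripleForm_eq_norm {d₁ d₂ d₃ : Quaternion ℝ} (h3 : 0 < ‖d₃‖)
    (a₁ a₂ a₃ b₁ b₂ b₃ : Quaternion ℝ) : ∃ h₁ h₂ h₃ : Quaternion ℝ,
      0 < ‖h₁‖ ^ 2 + ‖h₂‖ ^ 2 + ‖h₃‖ ^ 2 ∧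
      (a₁ * star h₁).re + (a₂ * star h₂).re + (a₃ * star h₃).re = 0 ∧
      (b₁ * star h₁).re + (b₂ * star h₂).re + (b₃ * star h₃).re = 0 ∧
      2 * tripleForm d₁ d₂ d₃ h₁ h₂ h₃ = ‖d₃‖ * (‖h₁‖ ^ 2 + ‖h₂‖ ^ 2 + ‖h₃‖ ^ 2) := by
  let f₁ : Quaternion ℝ →ₗ[ℝ] Quaternion ℝ := ‖d₃‖ • LinearMap.id
  let f₂ : Quaternion ℝ →ₗ[ℝ] Quaternion ℝ :=
    { toFun := fun ν => star (d₃ * ν)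
      map_add' := fun x y => by rw [mul_add, star_add]
      map_smul' := fun c x => by simp }
  obtain ⟨ν, h0, ha, hb⟩ := exists_orthogonal_triple
    (by rw [Quaternion.finrank_eq_four]; norm_num) f₁ f₂ 0 a₁ a₂ a₃ b₁ b₂ b₃
  have hν : 0 < ‖ν‖ := norm_pos_iff.2 h0
  have e1 : ‖f₁ ν‖ = ‖d₃‖ * ‖ν‖ := by
    change ‖‖d₃‖ • ν‖ = _
    rw [norm_smul, norm_norm]
  have e2 : ‖f₂ ν‖ = ‖d₃‖ * ‖ν‖ := by
    change ‖star (d₃ * ν)‖ = _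
    rw [_root_.norm_star, norm_mul]
  have e3 : ((0 : Quaternion ℝ →ₗ[ℝ] Quaternion ℝ) ν) = 0 := rfl
  refine ⟨f₁ ν, f₂ ν, 0, ?_, ha, hb, ?_⟩
  · rw [e1, e2]; positivity
  · have : f₁ ν * f₂ ν * d₃ = ((‖d₃‖ * (‖ν‖ * ‖ν‖ * (‖d₃‖ * ‖d₃‖)) : ℝ) : Quaternion ℝ) := by
      change (‖d₃‖ • ν) * star (d₃ * ν) * d₃ = _
      rw [star_mul, smul_mul_assoc, smul_mul_assoc, ← mul_assoc, Quaternion.self_mul_star,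
        mul_assoc, Quaternion.star_mul_self, Quaternion.normSq_eq_norm_mul_self,
        Quaternion.normSq_eq_norm_mul_self, ← Quaternion.coe_mul, Quaternion.smul_coe]
    simp only [tripleForm, mul_zero, Quaternion.re_zero, zero_add, this, Quaternion.re_coe, norm_zero, e1, e2]
    ring

/-- With `eᵢ = dᵢ / |dᵢ|` and `ν` purely imaginary, take `h₁ = ν ē₃ ē₂`, `h₂ = -e₂ e₃ ν ē₃`, `h₃ =
-e₃ ν`. The inner factors cancel, and `ν² = -|ν|²` makes two of the triple products real and
positive and the third a negative multiple of `d₁ d₂ d₃`. This wins when `Re (d₁ d₂ d₃)` is very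
negative. -/
theorem exists_tripleForm_eq {d₁ d₂ d₃ : Quaternion ℝ} (h2 : 0 < ‖d₂‖) (h3 : 0 < ‖d₃‖)
    (a₁ a₂ a₃ b₁ b₂ b₃ : Quaternion ℝ) : ∃ h₁ h₂ h₃ : Quaternion ℝ,
      0 < ‖h₁‖ ^ 2 + ‖h₂‖ ^ 2 + ‖h₃‖ ^ 2 ∧
      (a₁ * star h₁).re + (a₂ * star h₂).re + (a₃ * star h₃).re = 0 ∧
      (b₁ * star h₁).re + (b₂ * star h₂).re + (b₃ * star h₃).re = 0 ∧
      2 * tripleForm d₁ d₂ d₃ h₁ h₂ h₃ = 2 / 3 * (‖d₂‖ + ‖d₃‖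
        - (d₁ * d₂ * d₃).re / (‖d₂‖ * ‖d₃‖)) * (‖h₁‖ ^ 2 + ‖h₂‖ ^ 2 + ‖h₃‖ ^ 2) := by
  set e₂ : Quaternion ℝ := (‖d₂‖⁻¹ : ℝ) • d₂ with he₂
  set e₃ : Quaternion ℝ := (‖d₃‖⁻¹ : ℝ) • d₃ with he₃
  have u2 : ‖e₂‖ = 1 := by rw [norm_smul, norm_inv, norm_norm, inv_mul_cancel₀ h2.ne']
  have u3 : ‖e₃‖ = 1 := by rw [norm_smul, norm_inv, norm_norm, inv_mul_cancel₀ h3.ne']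
  have hd2 : d₂ = ‖d₂‖ • e₂ := by rw [he₂, smul_smul, mul_inv_cancel₀ h2.ne', one_smul]
  have hd3 : d₃ = ‖d₃‖ • e₃ := by rw [he₃, smul_smul, mul_inv_cancel₀ h3.ne', one_smul]
  have s2 : star e₂ * e₂ = 1 := by
    rw [Quaternion.star_mul_self, Quaternion.normSq_eq_norm_mul_self, u2]; norm_num
  have s3 : star e₃ * e₃ = 1 := by
    rw [Quaternion.star_mul_self, Quaternion.normSq_eq_norm_mul_self, u3]; norm_num
  let f₁ : (Fin 3 → ℝ) →ₗ[ℝ] Quaternion ℝ :=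
    (LinearMap.mulRight ℝ (star e₃ * star e₂)).comp imQuaternion
  let f₂ : (Fin 3 → ℝ) →ₗ[ℝ] Quaternion ℝ :=
    (LinearMap.mulLeft ℝ (-(e₂ * e₃))).comp ((LinearMap.mulRight ℝ (star e₃)).comp imQuaternion)
  let f₃ : (Fin 3 → ℝ) →ₗ[ℝ] Quaternion ℝ := (LinearMap.mulLeft ℝ (-e₃)).comp imQuaternion
  obtain ⟨v, h0, ha, hb⟩ := exists_orthogonal_triple (by simp) f₁ f₂ f₃ a₁ a₂ a₃ b₁ b₂ b₃
  have hν := imQuaternion_mul_self v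
  have hν0 : 0 < ‖imQuaternion v‖ := norm_pos_iff.2 (imQuaternion_ne_zero h0)
  have g1 : f₁ v = imQuaternion v * (star e₃ * star e₂) := rfl
  have g2 : f₂ v = -(e₂ * e₃) * (imQuaternion v * star e₃) := rfl
  have g3 : f₃ v = -e₃ * imQuaternion v := rfl
  have n1 : ‖f₁ v‖ = ‖imQuaternion v‖ := by
    rw [g1, norm_mul, norm_mul, _root_.norm_star, _root_.norm_star, u2, u3, mul_one, mul_one]
  have n2 : ‖f₂ v‖ = ‖imQuaternion v‖ := by
    rw [g2, norm_mul, norm_neg, norm_mul, norm_mul, _root_.norm_star, u2, u3, mul_one, one_mul, mul_one]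
  have n3 : ‖f₃ v‖ = ‖imQuaternion v‖ := by rw [g3, norm_mul, norm_neg, u3, one_mul]
  refine ⟨f₁ v, f₂ v, f₃ v, ?_, ha, hb, ?_⟩
  · rw [n1, n2, n3]; positivity
  rw [n1, n2, n3]
  set ν := imQuaternion v
  have q1 : d₁ * f₂ v * f₃ v = (-‖ν‖ ^ 2 / (‖d₂‖ * ‖d₃‖)) • (d₁ * d₂ * d₃) := by
    have : d₁ * f₂ v * f₃ v = d₁ * e₂ * e₃ * ν * (star e₃ * e₃) * ν := by rw [g2, g3]; noncomm_ring
    rw [this, s3, mul_one, mul_assoc _ ν ν, hν, he₂, he₃, mul_smul_comm, mul_smul_comm,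
      smul_mul_assoc, smul_mul_assoc, smul_mul_assoc, ← Quaternion.coe_commutes, Quaternion.coe_mul_eq_smul, smul_smul, smul_smul]
    congr 1
    field_simp
  have q2 : f₁ v * d₂ * f₃ v = ((‖d₂‖ * ‖ν‖ ^ 2 : ℝ) : Quaternion ℝ) := by
    have : f₁ v * d₂ * f₃ v = -(‖d₂‖ • (ν * (star e₃ * ((star e₂ * e₂) * e₃)) * ν)) := by
      conv_lhs => rw [g1, g3, hd2]
      simp only [mul_smul_comm, smul_mul_assoc, mul_assoc, neg_mul, mul_neg]
    rw [this, s2, one_mul, s3, mul_one, hν, Quaternion.smul_coe, ← Quaternion.coe_neg]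
    congr 1; ring
  have q3 : f₁ v * f₂ v * d₃ = ((‖d₃‖ * ‖ν‖ ^ 2 : ℝ) : Quaternion ℝ) := by
    have : f₁ v * f₂ v * d₃ = -(‖d₃‖ • (ν * (star e₃ * ((star e₂ * e₂) * e₃)) * ν * (star e₃ * e₃))) := by
      conv_lhs => rw [g1, g2, hd3]
      simp only [mul_smul_comm, mul_assoc, neg_mul, mul_neg, smul_neg]
    rw [this, s2, one_mul, s3, mul_one, mul_one, hν, Quaternion.smul_coe, ← Quaternion.coe_neg]
    congr 1; ring
  rw [tripleForm, q1, q2, q3, Quaternion.re_coe, Quaternion.re_coe, Quaternion.re_smul, smul_eq_mul]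
  ring

theorem exists_chord_direction_of_max {a₁ a₂ a₃ b₁ b₂ b₃ : Quaternion ℝ}
    (ha : ‖a₁‖ ^ 2 + ‖a₂‖ ^ 2 + ‖a₃‖ ^ 2 = 1) (hb : ‖b₁‖ ^ 2 + ‖b₂‖ ^ 2 + ‖b₃‖ ^ 2 = 1)
    (h13 : ‖a₁ - b₁‖ ≤ ‖a₃ - b₃‖) (h23 : ‖a₂ - b₂‖ ≤ ‖a₃ - b₃‖) (h3 : 0 < ‖a₃ - b₃‖) :
    (a₁ * a₂ * a₃).re - (b₁ * b₂ * b₃).re ≤ ‖a₃ - b₃‖ ∧ ∃ h₁ h₂ h₃ : Quaternion ℝ,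
      0 < ‖h₁‖ ^ 2 + ‖h₂‖ ^ 2 + ‖h₃‖ ^ 2 ∧
      (a₁ * star h₁).re + (a₂ * star h₂).re + (a₃ * star h₃).re = 0 ∧
      (b₁ * star h₁).re + (b₂ * star h₂).re + (b₃ * star h₃).re = 0 ∧
      ((a₁ * a₂ * a₃).re - (b₁ * b₂ * b₃).re + ‖a₃ - b₃‖ / 10 ^ 4)
          * (‖h₁‖ ^ 2 + ‖h₂‖ ^ 2 + ‖h₃‖ ^ 2)
        ≤ 2 * tripleForm (a₁ - b₁) (a₂ - b₂) (a₃ - b₃) h₁ h₂ h₃ := by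
  have par : ∀ a b : Quaternion ℝ,
      ‖(2⁻¹ : ℝ) • (a + b)‖ ^ 2 + ‖a - b‖ ^ 2 / 4 = (‖a‖ ^ 2 + ‖b‖ ^ 2) / 2 := fun a b => by
    rw [norm_smul, mul_pow, norm_add_sq_real, norm_sub_sq_real, Real.norm_eq_abs, sq_abs]; ring
  have ort : ∀ a b : Quaternion ℝ,
      ((2⁻¹ : ℝ) • (a + b) * star (a - b)).re = (‖a‖ ^ 2 - ‖b‖ ^ 2) / 2 := fun a b => by
    rw [← Quaternion.inner_def, real_inner_smul_left, inner_add_left, inner_sub_right,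
      inner_sub_right, real_inner_self_eq_norm_sq, real_inner_self_eq_norm_sq, real_inner_comm a b]
    ring
  obtain ⟨hle, hor⟩ := chord_dichotomy (m₁ := (2⁻¹ : ℝ) • (a₁ + b₁)) (m₂ := (2⁻¹ : ℝ) • (a₂ + b₂))
    (m₃ := (2⁻¹ : ℝ) • (a₃ + b₃)) (μ := (a₁ * a₂ * a₃).re - (b₁ * b₂ * b₃).re) h13 h23 h3
    (by linarith [par a₁ b₁, par a₂ b₂, par a₃ b₃]) (by rw [ort, ort, ort]; linarith)
    (by
      simp only [Quaternion.re_mul, Quaternion.imI_mul, Quaternion.imJ_mul, Quaternion.imK_mul,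
        Quaternion.re_sub, Quaternion.imI_sub, Quaternion.imJ_sub, Quaternion.imK_sub,
        Quaternion.re_add, Quaternion.imI_add, Quaternion.imJ_add, Quaternion.imK_add,
        Quaternion.re_smul, Quaternion.imI_smul, Quaternion.imJ_smul, Quaternion.imK_smul,
        smul_eq_mul]
      ring)
  refine ⟨hle, ?_⟩
  rcases hor with h | ⟨hd1, hd2, hP, g1, g2⟩
  · obtain ⟨h₁, h₂, h₃, hpos, oa, ob, e⟩ := exists_tripleForm_eq_norm (d₁ := a₁ - b₁)
      (d₂ := a₂ - b₂) h3 a₁ a₂ a₃ b₁ b₂ b₃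
    refine ⟨h₁, h₂, h₃, hpos, oa, ob, ?_⟩
    rw [e]
    exact mul_le_mul_of_nonneg_right (by linarith) hpos.le
  · obtain ⟨h₁, h₂, h₃, hpos, oa, ob, e⟩ := exists_tripleForm_eq (d₁ := a₁ - b₁) hd2 h3
      a₁ a₂ a₃ b₁ b₂ b₃
    refine ⟨h₁, h₂, h₃, hpos, oa, ob, ?_⟩
    rw [e]
    refine mul_le_mul_of_nonneg_right ?_ hpos.le
    -- The value is then at least `2 / 3 * (0.99 + 1 + 0.9 * 0.99) > 1.9` times `‖a₃ - b₃‖`, well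
    -- above what is needed.
    have : ((a₁ - b₁) * (a₂ - b₂) * (a₃ - b₃)).re / (‖a₂ - b₂‖ * ‖a₃ - b₃‖)
        ≤ -(9 / 10) * ‖a₁ - b₁‖ := by
      rw [div_le_iff₀ (by positivity)]; linarith
    linarith

/-- Here `δ` is the largest of the three block differences; `re_mul_rotate` and `tripleForm_rotate`
move it cyclically into third place. -/
theorem exists_chord_direction {a₁ a₂ a₃ b₁ b₂ b₃ : Quaternion ℝ}
    (ha : ‖a₁‖ ^ 2 + ‖a₂‖ ^ 2 + ‖a₃‖ ^ 2 = 1) (hb : ‖b₁‖ ^ 2 + ‖b₂‖ ^ 2 + ‖b₃‖ ^ 2 = 1)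
    (hne : 0 < ‖a₁ - b₁‖ ^ 2 + ‖a₂ - b₂‖ ^ 2 + ‖a₃ - b₃‖ ^ 2) :
    ∃ δ : ℝ, ‖a₁ - b₁‖ ^ 2 + ‖a₂ - b₂‖ ^ 2 + ‖a₃ - b₃‖ ^ 2 ≤ 3 * δ ^ 2 ∧ 0 < δ ∧
      (a₁ * a₂ * a₃).re - (b₁ * b₂ * b₃).re ≤ δ ∧ ∃ h₁ h₂ h₃ : Quaternion ℝ,
      0 < ‖h₁‖ ^ 2 + ‖h₂‖ ^ 2 + ‖h₃‖ ^ 2 ∧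
      (a₁ * star h₁).re + (a₂ * star h₂).re + (a₃ * star h₃).re = 0 ∧
      (b₁ * star h₁).re + (b₂ * star h₂).re + (b₃ * star h₃).re = 0 ∧
      ((a₁ * a₂ * a₃).re - (b₁ * b₂ * b₃).re + δ / 10 ^ 4) * (‖h₁‖ ^ 2 + ‖h₂‖ ^ 2 + ‖h₃‖ ^ 2)
        ≤ 2 * tripleForm (a₁ - b₁) (a₂ - b₂) (a₃ - b₃) h₁ h₂ h₃ := by
  have n1 := norm_nonneg (a₁ - b₁)
  have n2 := norm_nonneg (a₂ - b₂)
  have n3 := norm_nonneg (a₃ - b₃)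
  have sqle : ∀ {x y : ℝ}, 0 ≤ x → x ≤ y → x ^ 2 ≤ y ^ 2 := fun hx h => pow_le_pow_left₀ hx h 2
  have pos : ∀ {x y z : ℝ}, 0 < x ^ 2 + y ^ 2 + z ^ 2 → 0 ≤ x → 0 ≤ y → 0 ≤ z → x ≤ z → y ≤ z →
      0 < z := by
    intro x y z h hx hy hz hxz hyz
    rcases hz.eq_or_lt with h0 | h0
    · have hx0 : x = 0 := by linarith
      have hy0 : y = 0 := by linarith
      rw [hx0, hy0, ← h0] at h
      norm_num at h
    · exact h0
  by_cases c3 : ‖a₁ - b₁‖ ≤ ‖a₃ - b₃‖ ∧ ‖a₂ - b₂‖ ≤ ‖a₃ - b₃‖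
  · have h0 := pos hne n1 n2 n3 c3.1 c3.2
    exact ⟨_, by linarith [sqle n1 c3.1, sqle n2 c3.2], h0,
      exists_chord_direction_of_max ha hb c3.1 c3.2 h0⟩
  by_cases c1 : ‖a₂ - b₂‖ ≤ ‖a₁ - b₁‖ ∧ ‖a₃ - b₃‖ ≤ ‖a₁ - b₁‖
  · have h0 := pos (by linarith) n2 n3 n1 c1.1 c1.2
    obtain ⟨hle, h₂, h₃, h₁, hpos, oa, ob, e⟩ :=
      exists_chord_direction_of_max (a₁ := a₂) (a₂ := a₃) (a₃ := a₁) (b₁ := b₂) (b₂ := b₃)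
        (b₃ := b₁) (by linarith) (by linarith) c1.1 c1.2 h0
    rw [← re_mul_rotate a₁, ← re_mul_rotate b₁] at hle e
    rw [tripleForm_rotate] at e
    refine ⟨_, by linarith [sqle n2 c1.1, sqle n3 c1.2], h0, hle, h₁, h₂, h₃, by linarith,
      by linarith, by linarith, ?_⟩
    rwa [show ‖h₁‖ ^ 2 + ‖h₂‖ ^ 2 + ‖h₃‖ ^ 2 = ‖h₂‖ ^ 2 + ‖h₃‖ ^ 2 + ‖h₁‖ ^ 2 by ring]
  · have c2 : ‖a₃ - b₃‖ ≤ ‖a₂ - b₂‖ ∧ ‖a₁ - b₁‖ ≤ ‖a₂ - b₂‖ := by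
      rcases le_total ‖a₃ - b₃‖ ‖a₂ - b₂‖ with h | h <;>
      rcases le_total ‖a₁ - b₁‖ ‖a₂ - b₂‖ with h' | h'
      · exact ⟨h, h'⟩
      · exact absurd ⟨h', h.trans h'⟩ c1
      · exact absurd ⟨h'.trans h, h⟩ c3
      · rcases le_total ‖a₁ - b₁‖ ‖a₃ - b₃‖ with h'' | h''
        · exact absurd ⟨h'', h⟩ c3
        · exact absurd ⟨h', h''⟩ c1
    have h0 := pos (by linarith) n3 n1 n2 c2.1 c2.2
    obtain ⟨hle, h₃, h₁, h₂, hpos, oa, ob, e⟩ :=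
      exists_chord_direction_of_max (a₁ := a₃) (a₂ := a₁) (a₃ := a₂) (b₁ := b₃) (b₂ := b₁)
        (b₃ := b₂) (by linarith) (by linarith) c2.1 c2.2 h0
    rw [re_mul_rotate a₃, re_mul_rotate b₃] at hle e
    rw [← tripleForm_rotate] at e
    refine ⟨_, by linarith [sqle n3 c2.1, sqle n1 c2.2], h0, hle, h₁, h₂, h₃, by linarith,
      by linarith, by linarith, ?_⟩
    rwa [show ‖h₁‖ ^ 2 + ‖h₂‖ ^ 2 + ‖h₃‖ ^ 2 = ‖h₃‖ ^ 2 + ‖h₁‖ ^ 2 + ‖h₂‖ ^ 2 by ring]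

/-! ### Symmetric matrices tested on rank-one matrices, and monotonicity of elliptic functions. -/

section SymMat
variable {n : ℕ}

theorem inner_rankOne (A : SymMat n) (ξ : EuclideanSpace ℝ (Fin n)) :
    inner ℝ A (rankOne ξ)
      = ∑ i, ∑ j, (A : EuclideanSpace ℝ (Fin n × Fin n)) (i, j) * (ξ i * ξ j) := by
  rw [Submodule.coe_inner, PiLp.inner_apply, Fintype.sum_prod_type]
  refine Finset.sum_congr rfl fun i _ => Finset.sum_congr rfl fun j _ => ?_
  simp only [rankOne, RCLike.inner_apply, conj_trivial]
  ring

theorem inner_rankOne_rankOne (η ξ : EuclideanSpace ℝ (Fin n)) :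
    inner ℝ (rankOne η) (rankOne ξ) = (inner ℝ η ξ) ^ 2 := by
  rw [inner_rankOne, PiLp.inner_apply, sq, Finset.sum_mul_sum]
  refine Finset.sum_congr rfl fun i _ => Finset.sum_congr rfl fun j _ => ?_
  simp only [rankOne, RCLike.inner_apply, conj_trivial]
  ring

theorem norm_rankOne (ξ : EuclideanSpace ℝ (Fin n)) : ‖rankOne ξ‖ = ‖ξ‖ ^ 2 := by
  have h := inner_rankOne_rankOne ξ ξ
  rw [real_inner_self_eq_norm_sq, real_inner_self_eq_norm_sq] at h
  exact (pow_left_inj₀ (norm_nonneg _) (sq_nonneg _) two_ne_zero).1 h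

theorem rankOne_smul (c : ℝ) (ξ : EuclideanSpace ℝ (Fin n)) :
    rankOne (c • ξ) = c ^ 2 • rankOne ξ := by
  ext p
  simp [rankOne]
  ring

theorem rankOne_single_add_single (i j : Fin n) (A : SymMat n) :
    inner ℝ A (rankOne (EuclideanSpace.single i 1 + EuclideanSpace.single j 1))
      = (A : EuclideanSpace ℝ (Fin n × Fin n)) (i, i) + (A : EuclideanSpace ℝ (Fin n × Fin n)) (j, j)
        + 2 * (A : EuclideanSpace ℝ (Fin n × Fin n)) (i, j) := by
  have hs : (A : EuclideanSpace ℝ (Fin n × Fin n)) (j, i)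
      = (A : EuclideanSpace ℝ (Fin n × Fin n)) (i, j) := A.2 j i
  rw [inner_rankOne]
  simp only [PiLp.add_apply, PiLp.single_apply, mul_add, mul_ite, mul_one, mul_zero,
    Finset.sum_add_distrib, Finset.sum_ite_eq', Finset.mem_univ, if_true]
  rw [hs]; ring

theorem SymMat.ext_rankOne {A B : SymMat n}
    (h : ∀ ξ, inner ℝ A (rankOne ξ) = inner ℝ B (rankOne ξ)) : A = B := by
  have hd : ∀ i, (A : EuclideanSpace ℝ (Fin n × Fin n)) (i, i)
      = (B : EuclideanSpace ℝ (Fin n × Fin n)) (i, i) := by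
    intro i
    have := h (EuclideanSpace.single i 1 + EuclideanSpace.single i 1)
    rw [rankOne_single_add_single, rankOne_single_add_single] at this
    linarith
  ext ⟨i, j⟩
  have := h (EuclideanSpace.single i 1 + EuclideanSpace.single j 1)
  rw [rankOne_single_add_single, rankOne_single_add_single] at this
  linarith [hd i, hd j]

-- Factor the positive semidefinite matrix as `Bᵀ B` and take the rows of `B`. This turns
-- ellipticity, which concerns rank-one directions only, into monotonicity.
open scoped MatrixOrder Matrix.Norms.L2Operator in
theorem SymMat.exists_eq_sum_rankOne {A : SymMat n} (h : ∀ ξ, 0 ≤ inner ℝ A (rankOne ξ)) :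
    ∃ v : Fin n → EuclideanSpace ℝ (Fin n), A = ∑ k, rankOne (v k) := by
  let M : Matrix (Fin n) (Fin n) ℝ :=
    fun i j => (A : EuclideanSpace ℝ (Fin n × Fin n)) (i, j)
  have hM : M.PosSemidef := by
    refine Matrix.PosSemidef.of_dotProduct_mulVec_nonneg ?_ ?_
    · ext i j
      exact A.2 j i
    · intro x
      have := h (WithLp.toLp 2 x)
      rw [inner_rankOne] at this
      refine this.trans_eq (Finset.sum_congr rfl fun i _ => ?_)
      rw [Matrix.mulVec, dotProduct, Finset.mul_sum]
      refine Finset.sum_congr rfl fun j _ => ?_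
      simp only [M, Pi.star_apply, star_trivial]
      ring
  obtain ⟨B, hB⟩ := CStarAlgebra.nonneg_iff_eq_star_mul_self.mp hM.nonneg
  refine ⟨fun k => WithLp.toLp 2 (B k), ?_⟩
  ext ⟨i, j⟩
  have := congrFun (congrFun hB i) j
  simp only [Matrix.mul_apply, Matrix.star_apply, star_trivial] at this
  change M i j = _
  rw [this, Submodule.coe_sum, WithLp.ofLp_sum, Finset.sum_apply]
  rfl

theorem inner_hessian_rankOne (u : EuclideanSpace ℝ (Fin n) → ℝ) (x ξ : EuclideanSpace ℝ (Fin n)) :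
    inner ℝ (hessian u x) (rankOne ξ) = fderiv ℝ (fderiv ℝ u) x ξ ξ := by
  have hξ : ξ = ∑ i, ξ i • EuclideanSpace.single i (1 : ℝ) := by
    ext j
    simp [WithLp.ofLp_sum, Finset.sum_apply, Pi.single_apply]
  have e : fderiv ℝ (fderiv ℝ u) x ξ ξ = ∑ i, ∑ j, secondPartial u x i j * (ξ i * ξ j) := by
    conv_lhs => rw [hξ]
    simp only [map_sum, map_smul, sum_apply, smul_apply,
      smul_eq_mul, secondPartial, Finset.mul_sum]
    rw [Finset.sum_comm]
    refine Finset.sum_congr rfl fun i _ => Finset.sum_congr rfl fun j _ => ?_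
    ring
  have e' : fderiv ℝ (fderiv ℝ u) x ξ ξ = ∑ i, ∑ j, secondPartial u x j i * (ξ i * ξ j) := by
    rw [e, Finset.sum_comm]
    refine Finset.sum_congr rfl fun i _ => Finset.sum_congr rfl fun j _ => ?_
    ring
  rw [inner_rankOne]
  have : fderiv ℝ (fderiv ℝ u) x ξ ξ
      = (fderiv ℝ (fderiv ℝ u) x ξ ξ + fderiv ℝ (fderiv ℝ u) x ξ ξ) / 2 := by ring
  rw [this]
  nth_rw 1 [e]
  rw [e', ← Finset.sum_add_distrib, Finset.sum_div]
  refine Finset.sum_congr rfl fun i _ => ?_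
  rw [← Finset.sum_add_distrib, Finset.sum_div]
  refine Finset.sum_congr rfl fun j _ => ?_
  simp only [hessian]
  ring

theorem SymMat.mono_of_fderiv_rankOne_nonneg {F : SymMat n → ℝ} (hF : Differentiable ℝ F)
    (h : ∀ A ξ, 0 ≤ fderiv ℝ F A (rankOne ξ)) {A B : SymMat n}
    (hAB : ∀ ξ, inner ℝ A (rankOne ξ) ≤ inner ℝ B (rankOne ξ)) : F A ≤ F B := by
  obtain ⟨v, hv⟩ := SymMat.exists_eq_sum_rankOne (A := B - A) (fun ξ => by
    rw [inner_sub_left]; linarith [hAB ξ])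
  have hd : ∀ t : ℝ, HasDerivAt (fun t : ℝ => F (A + t • (B - A)))
      (fderiv ℝ F (A + t • (B - A)) (B - A)) t := fun t => by
    have h1 : HasDerivAt (fun t : ℝ => A + t • (B - A)) (B - A) t := by
      simpa using ((hasDerivAt_id t).smul_const (B - A)).const_add A
    exact (hF _).hasFDerivAt.comp_hasDerivAt t h1
  have hm : Monotone fun t : ℝ => F (A + t • (B - A)) := by
    refine monotone_of_deriv_nonneg (fun t => (hd t).differentiableAt) fun t => ?_
    rw [(hd t).deriv, hv, map_sum]
    exact Finset.sum_nonneg fun k _ => h _ _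
  simpa using hm zero_le_one

end SymMat

/-! ### Second derivatives along lines. -/

section SecondDerivative
variable {E : Type*} [NormedAddCommGroup E] [NormedSpace ℝ E]

theorem hasDerivAt_line {u : E → ℝ} {x : E} (hu : ContDiffAt ℝ 2 u x) (ξ : E) :
    (∀ᶠ t : ℝ in 𝓝 0, HasDerivAt (fun t : ℝ => u (x + t • ξ)) (fderiv ℝ u (x + t • ξ) ξ) t) ∧
      HasDerivAt (fun t : ℝ => fderiv ℝ u (x + t • ξ) ξ) (fderiv ℝ (fderiv ℝ u) x ξ ξ) 0 := by
  have hl : ∀ t : ℝ, HasDerivAt (fun t : ℝ => x + t • ξ) ξ t := fun t => by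
    simpa using ((hasDerivAt_id t).smul_const ξ).const_add x
  have h0 : x + (0 : ℝ) • ξ = x := by simp
  constructor
  · have hd : ∀ᶠ y in 𝓝 x, DifferentiableAt ℝ u y := by
      filter_upwards [hu.eventually (by simp)] with y hy using hy.differentiableAt (by simp)
    have ht : Tendsto (fun t : ℝ => x + t • ξ) (𝓝 0) (𝓝 x) := by
      have := (hl 0).continuousAt.tendsto
      rwa [h0] at this
    filter_upwards [ht.eventually hd] with t h using h.hasFDerivAt.comp_hasDerivAt t (hl t)
  · have hd : DifferentiableAt ℝ (fderiv ℝ u) (x + (0 : ℝ) • ξ) := by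
      rw [h0]
      exact (hu.fderiv_right (m := 1) (by norm_num)).differentiableAt (by simp)
    have h1 : HasFDerivAt (fun L : E →L[ℝ] ℝ => L ξ) (ContinuousLinearMap.apply ℝ ℝ ξ)
        (fderiv ℝ u (x + (0 : ℝ) • ξ)) := (ContinuousLinearMap.apply ℝ ℝ ξ).hasFDerivAt
    have h2 := hd.hasFDerivAt.comp_hasDerivAt (0 : ℝ) (hl 0)
    rw [h0] at h2
    exact h1.comp_hasDerivAt (0 : ℝ) h2

theorem fderiv_fderiv_eq_of_line {u : E → ℝ} {x : E} (hu : ContDiffAt ℝ 2 u x) {ξ : E}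
    {g : ℝ → ℝ} {c : ℝ} (h : ∀ᶠ t : ℝ in 𝓝 0, HasDerivAt (fun t : ℝ => u (x + t • ξ)) (g t) t)
    (hg : HasDerivAt g c 0) : fderiv ℝ (fderiv ℝ u) x ξ ξ = c := by
  obtain ⟨h1, h2⟩ := hasDerivAt_line hu ξ
  refine (h2.congr_of_eventuallyEq ?_).unique hg
  filter_upwards [h, h1] with t ht ht1 using ht.unique ht1

theorem fderiv_fderiv_nonpos_of_isLocalMax {u : E → ℝ} {x : E} (hu : ContDiffAt ℝ 2 u x)
    (hx : IsLocalMax u x) (ξ : E) : fderiv ℝ (fderiv ℝ u) x ξ ξ ≤ 0 := by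
  obtain ⟨h1, h2⟩ := hasDerivAt_line hu ξ
  by_contra! hpos
  set k : ℝ → ℝ := fun t => u (x + t • ξ) with hk
  have hde : deriv k =ᶠ[𝓝 0] fun t => fderiv ℝ u (x + t • ξ) ξ := by
    filter_upwards [h1] with t ht using ht.deriv
  have hdd : deriv (deriv k) 0 = fderiv ℝ (fderiv ℝ u) x ξ ξ := by
    rw [hde.deriv_eq, h2.deriv]
  have hc : ContinuousAt k 0 := h1.self_of_nhds.continuousAt
  have hmax : IsLocalMax k 0 := by
    have hx' : IsLocalMax u (x + (0 : ℝ) • ξ) := by simpa using hx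
    have hcl : ContinuousAt (fun t : ℝ => x + t • ξ) 0 := by fun_prop
    exact hx'.comp_continuous (g := fun t : ℝ => x + t • ξ) hcl
  -- A positive second derivative would make `0` a local minimum too, so `k` would be constant near
  -- `0` and its second derivative zero.
  have hmin : IsLocalMin k 0 :=
    isLocalMin_of_deriv_deriv_pos (by rw [hdd]; exact hpos) hmax.deriv_eq_zero hc
  have hconst : k =ᶠ[𝓝 0] fun _ => k 0 := by
    filter_upwards [hmax, hmin] with t h1 h2 using le_antisymm h1 h2
  have : deriv (deriv k) 0 = 0 := by
    have e : deriv k =ᶠ[𝓝 0] fun _ => 0 := by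
      filter_upwards [hconst.eventuallyEq_nhds] with t ht
      rw [ht.deriv_eq]; simp
    rw [e.deriv_eq]; simp
  linarith

end SecondDerivative

/-! ### Viscosity solutions homogeneous of order two, and the maximum principle. -/

section Viscosity
variable {n : ℕ}

theorem fderiv_fderiv_sub_apply {E : Type*} [NormedAddCommGroup E] [NormedSpace ℝ E]
    {u v : E → ℝ} {x : E} (hu : ContDiffAt ℝ 2 u x) (hv : ContDiffAt ℝ 2 v x) (ξ : E) :
    fderiv ℝ (fderiv ℝ (fun y => u y - v y)) x ξ ξ
      = fderiv ℝ (fderiv ℝ u) x ξ ξ - fderiv ℝ (fderiv ℝ v) x ξ ξ := by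
  obtain ⟨h1, h2⟩ := hasDerivAt_line hu ξ
  obtain ⟨h3, h4⟩ := hasDerivAt_line hv ξ
  refine fderiv_fderiv_eq_of_line (hu.sub hv) ?_ (h2.sub h4)
  filter_upwards [h1, h3] with t a b using a.sub b

theorem hasDerivAt_quadratic (a b c t : ℝ) :
    HasDerivAt (fun t : ℝ => a + t * b + t ^ 2 * c) (b + 2 * t * c) t := by
  have h1 : HasDerivAt (fun t : ℝ => a + t * b) (1 * b) t :=
    ((hasDerivAt_id' t).mul_const b).const_add a
  have h2 : HasDerivAt (fun t : ℝ => t ^ 2 * c) (2 * t ^ 1 * 1 * c) t :=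
    ((hasDerivAt_id' t).fun_pow 2).mul_const c
  exact (h1.fun_add h2).congr_deriv (by ring)

/-- The real inner product as a continuous bilinear form. -/
noncomputable def innerCLM (E : Type*) [NormedAddCommGroup E] [InnerProductSpace ℝ E] :
    E →L[ℝ] E →L[ℝ] ℝ :=
  (innerₗ E).mkContinuous₂ 1 fun x y => by
    rw [one_mul]; exact norm_inner_le_norm x y

theorem innerCLM_apply {E : Type*} [NormedAddCommGroup E] [InnerProductSpace ℝ E] (x y : E) :
    innerCLM E x y = inner ℝ x y := rfl

theorem hasDerivAt_quadratic_line {E : Type*} [NormedAddCommGroup E] [InnerProductSpace ℝ E]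
    (B : E →L[ℝ] E →L[ℝ] ℝ) (x ξ : E) :
    (∀ t : ℝ, HasDerivAt (fun t : ℝ => B (x + t • ξ) (x + t • ξ))
      (B (x + t • ξ) ξ + B ξ (x + t • ξ)) t) ∧
    HasDerivAt (fun t : ℝ => B (x + t • ξ) ξ + B ξ (x + t • ξ)) (B ξ ξ + B ξ ξ) 0 := by
  have hl : ∀ t : ℝ, HasDerivAt (fun t : ℝ => x + t • ξ) ξ t := fun t => by
    simpa using ((hasDerivAt_id t).smul_const ξ).const_add x
  have e1 : ∀ t : ℝ, B (x + t • ξ) (x + t • ξ) = B x x + t * (B x ξ + B ξ x) + t ^ 2 * B ξ ξ := by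
    intro t
    simp only [map_add, map_smul, add_apply, smul_apply, smul_eq_mul]
    ring
  have e2 : ∀ t : ℝ, B (x + t • ξ) ξ + B ξ (x + t • ξ) = (B x ξ + B ξ x) + t * (B ξ ξ + B ξ ξ) := by
    intro t
    simp only [map_add, map_smul, add_apply, smul_apply, smul_eq_mul]
    ring
  constructor
  · intro t
    simp only [e1, e2]
    exact (hasDerivAt_quadratic _ _ _ t).congr_deriv (by ring)
  · simp only [e2]
    have := hasDerivAt_quadratic (B x ξ + B ξ x) (B ξ ξ + B ξ ξ) 0 0
    simpa using this

theorem fderiv_fderiv_quadratic {E : Type*} [NormedAddCommGroup E] [InnerProductSpace ℝ E]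
    (B : E →L[ℝ] E →L[ℝ] ℝ) (x ξ : E) :
    fderiv ℝ (fderiv ℝ (fun y => B y y)) x ξ ξ = B ξ ξ + B ξ ξ :=
  fderiv_fderiv_eq_of_line (by fun_prop)
    (Eventually.of_forall (hasDerivAt_quadratic_line B x ξ).1) (hasDerivAt_quadratic_line B x ξ).2

/-- A `C²` test function touching from above at `0` a function that is homogeneous of order `2`
dominates it to second order. -/
theorem le_half_fderiv_fderiv_of_homogeneous {E : Type*} [NormedAddCommGroup E] [NormedSpace ℝ E]
    {u φ : E → ℝ} (hhom : ∀ (t : ℝ) (x : E), 0 < t → u (t • x) = t ^ 2 * u x) (h0 : u 0 = 0)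
    (hφ : ContDiffAt ℝ 2 φ 0) (hmax : IsLocalMax (fun y => u y - φ y) 0) (ξ : E) :
    u ξ ≤ fderiv ℝ (fderiv ℝ φ) 0 ξ ξ / 2 := by
  have hle : ∀ ξ : E, ∀ᶠ t : ℝ in 𝓝[>] 0, t ^ 2 * u ξ ≤ φ (t • ξ) - φ 0 := by
    intro ξ
    have ht : Tendsto (fun t : ℝ => t • ξ) (𝓝[>] 0) (𝓝 0) := by
      have : Tendsto (fun t : ℝ => t • ξ) (𝓝 0) (𝓝 ((0 : ℝ) • ξ)) :=
        (continuous_id.smul continuous_const).tendsto 0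
      rw [zero_smul] at this
      exact this.mono_left nhdsWithin_le_nhds
    filter_upwards [ht.eventually hmax, self_mem_nhdsWithin] with t h hpos
    rw [hhom t ξ hpos, h0] at h
    linarith
  -- Dividing `hle` by `t` removes the quadratic term as `t → 0`; using `ξ` and `-ξ`, the gradient
  -- of `φ` at `0` vanishes.
  have hD : ∀ ξ : E, 0 ≤ fderiv ℝ φ 0 ξ := by
    intro ξ
    have hd : HasDerivAt (fun t : ℝ => φ (t • ξ)) (fderiv ℝ φ 0 ξ) 0 := by
      have := (hasDerivAt_line hφ ξ).1.self_of_nhds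
      simpa using this
    have h1 : Tendsto (fun t : ℝ => t⁻¹ * (φ (t • ξ) - φ 0)) (𝓝[>] 0) (𝓝 (fderiv ℝ φ 0 ξ)) := by
      have := hd.tendsto_slope_zero_right
      simpa using this
    have h2 : Tendsto (fun t : ℝ => t * u ξ) (𝓝[>] 0) (𝓝 0) := by
      have : Tendsto (fun t : ℝ => t * u ξ) (𝓝 0) (𝓝 (0 * u ξ)) :=
        (continuous_id.mul continuous_const).tendsto 0
      rw [zero_mul] at this
      exact this.mono_left nhdsWithin_le_nhds
    refine le_of_tendsto_of_tendsto h2 h1 ?_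
    filter_upwards [hle ξ, self_mem_nhdsWithin] with t h hpos
    have hpos' : 0 < t := hpos
    rw [inv_mul_eq_div, le_div_iff₀ hpos']
    linarith
  have hz : fderiv ℝ φ 0 ξ = 0 := by
    have := hD (-ξ)
    rw [map_neg] at this
    linarith [hD ξ]
  by_contra! hlt
  obtain ⟨s, hs1, hs2⟩ := exists_between hlt
  obtain ⟨h1, h2⟩ := hasDerivAt_line hφ ξ
  simp only [zero_add] at h1 h2
  -- With `s` strictly between, `k` has a local maximum at `0`, while `hle` forces `k t > k 0` for
  -- small `t > 0`.
  set k : ℝ → ℝ := fun t => φ (t • ξ) - t ^ 2 * s with hk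
  have hkd : ∀ᶠ t in 𝓝 (0 : ℝ), HasDerivAt k (fderiv ℝ φ (t • ξ) ξ - 2 * t * s) t := by
    filter_upwards [h1] with t ht
    have := hasDerivAt_quadratic 0 0 s t
    simp only [mul_zero, zero_add] at this
    exact ht.fun_sub this
  have hde : deriv k =ᶠ[𝓝 0] fun t => fderiv ℝ φ (t • ξ) ξ - 2 * t * s := by
    filter_upwards [hkd] with t ht using ht.deriv
  have hdd : deriv (deriv k) 0 = fderiv ℝ (fderiv ℝ φ) 0 ξ ξ - 2 * s := by
    rw [hde.deriv_eq]
    have := hasDerivAt_quadratic 0 (2 * s) 0 0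
    simp only [mul_zero, add_zero, zero_add] at this
    refine ((h2.fun_sub this).congr_of_eventuallyEq (Eventually.of_forall fun t => ?_)).deriv
    ring
  have hmx : IsLocalMax k 0 := by
    refine isLocalMax_of_deriv_deriv_neg (by rw [hdd]; linarith) ?_ hkd.self_of_nhds.continuousAt
    rw [hkd.self_of_nhds.deriv]
    simp [hz]
  have : ∀ᶠ t : ℝ in 𝓝[>] 0, False := by
    filter_upwards [hle ξ, hmx.filter_mono nhdsWithin_le_nhds, self_mem_nhdsWithin] with t a b hpos
    have hpos' : 0 < t := hpos
    have hk0 : k 0 = φ 0 := by simp [hk]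
    rw [hk0] at b
    simp only [hk] at b
    nlinarith [mul_pos hpos' hpos']
  exact (this.exists.choose_spec)

/-- Off the origin, compare Hessians at the contact point. At the origin, `D²φ(0) / 2` dominates `u`
as a quadratic form; lowering it by the largest `m |y|²` that keeps it above `u` gives contact at a
point of the sphere, where the first case applies, and `F` is monotone. -/
theorem subsolution_of_homogeneous {n : ℕ} [NeZero n] {u : EuclideanSpace ℝ (Fin n) → ℝ}
    {F : SymMat n → ℝ} (hu : Continuous u)
    (hhom : ∀ (t : ℝ) (x : EuclideanSpace ℝ (Fin n)), 0 < t → u (t • x) = t ^ 2 * u x)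
    (hsm : ∀ x ≠ 0, ContDiffAt ℝ 2 u x) (hF : Differentiable ℝ F)
    (hell : ∀ A ξ, 0 ≤ fderiv ℝ F A (rankOne ξ)) (hz : ∀ x ≠ 0, 0 ≤ F (hessian u x))
    {x : EuclideanSpace ℝ (Fin n)} {φ : EuclideanSpace ℝ (Fin n) → ℝ} (hφ : ContDiffAt ℝ 2 φ x)
    (hmax : IsLocalMax (fun y => u y - φ y) x) : 0 ≤ F (hessian φ x) := by
  have main : ∀ {x : EuclideanSpace ℝ (Fin n)} {φ : EuclideanSpace ℝ (Fin n) → ℝ}, x ≠ 0 →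
      ContDiffAt ℝ 2 φ x → IsLocalMax (fun y => u y - φ y) x → 0 ≤ F (hessian φ x) := by
    intro x φ hx hφ hmax
    refine (hz x hx).trans (SymMat.mono_of_fderiv_rankOne_nonneg hF hell fun ξ => ?_)
    rw [inner_hessian_rankOne, inner_hessian_rankOne]
    have := fderiv_fderiv_nonpos_of_isLocalMax ((hsm x hx).sub hφ) hmax ξ
    rw [fderiv_fderiv_sub_apply (hsm x hx) hφ] at this
    linarith
  rcases ne_or_eq x 0 with hx | rfl
  · exact main hx hφ hmax
  have h0 : u 0 = 0 := by
    have := hhom 2 0 (by norm_num)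
    rw [smul_zero] at this
    linarith
  have hle := le_half_fderiv_fderiv_of_homogeneous hhom h0 hφ hmax
  set B := fderiv ℝ (fderiv ℝ φ) 0 with hB
  have hcont : Continuous fun ξ : EuclideanSpace ℝ (Fin n) => B ξ ξ / 2 - u ξ := by fun_prop
  obtain ⟨x, hxs, hxm⟩ := (isCompact_sphere (0 : EuclideanSpace ℝ (Fin n)) 1).exists_isMinOn
    (NormedSpace.sphere_nonempty.2 zero_le_one) hcont.continuousOn
  have hx1 : ‖x‖ = 1 := by simpa using hxs
  have hx0 : x ≠ 0 := by
    rintro rfl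
    simp at hx1
  set m := B x x / 2 - u x with hm
  have hm0 : 0 ≤ m := by linarith [hle x]
  let ψB : EuclideanSpace ℝ (Fin n) →L[ℝ] EuclideanSpace ℝ (Fin n) →L[ℝ] ℝ :=
    (1 / 2 : ℝ) • B - m • innerCLM _
  have hψ : ∀ y, ψB y y = B y y / 2 - m * ‖y‖ ^ 2 := by
    intro y
    simp only [ψB, sub_apply, smul_apply, smul_eq_mul, innerCLM_apply,
      real_inner_self_eq_norm_sq]
    ring
  have hge : ∀ y, u y - ψB y y ≤ 0 := by
    intro y
    rcases eq_or_ne y 0 with rfl | hy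
    · simp [h0]
    have hy0 : 0 < ‖y‖ := norm_pos_iff.2 hy
    have hs : ‖y‖⁻¹ • y ∈ Metric.sphere (0 : EuclideanSpace ℝ (Fin n)) 1 := by
      simp [norm_smul, hy0.ne']
    have := hxm hs
    simp only [Set.mem_ofPred_eq] at this
    rw [← hm, hhom _ _ (inv_pos.2 hy0)] at this
    simp only [map_smul, smul_apply, smul_eq_mul] at this
    have e : (‖y‖⁻¹ * (‖y‖⁻¹ * B y y) / 2 - ‖y‖⁻¹ ^ 2 * u y) * ‖y‖ ^ 2 = B y y / 2 - u y := by
      field_simp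
    have := mul_le_mul_of_nonneg_right this (sq_nonneg ‖y‖)
    rw [e] at this
    rw [hψ]
    linarith
  have heq : u x - ψB x x = 0 := by
    rw [hψ, hx1, hm]; ring
  have hloc : IsLocalMax (fun y => u y - ψB y y) x :=
    Eventually.of_forall fun y => by
      change u y - ψB y y ≤ u x - ψB x x
      rw [heq]; exact hge y
  refine (main hx0 (φ := fun y => ψB y y) (by fun_prop) hloc).trans
    (SymMat.mono_of_fderiv_rankOne_nonneg hF hell fun ξ => ?_)
  rw [inner_hessian_rankOne, inner_hessian_rankOne, fderiv_fderiv_quadratic, hψ, ← hB]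
  nlinarith [mul_nonneg hm0 (sq_nonneg ‖ξ‖)]

theorem hessian_neg (u : EuclideanSpace ℝ (Fin n) → ℝ) (x : EuclideanSpace ℝ (Fin n)) :
    hessian (fun y => -u y) x = -hessian u x := by
  refine SymMat.ext_rankOne fun ξ => ?_
  rw [inner_neg_left, inner_hessian_rankOne, inner_hessian_rankOne]
  have : fderiv ℝ (fun y => -u y) = fun y => -fderiv ℝ u y := by
    funext y; exact fderiv_fun_neg
  rw [this, fderiv_fun_neg]
  simp

theorem isViscositySolution_of_homogeneous {n : ℕ} [NeZero n] {u : EuclideanSpace ℝ (Fin n) → ℝ}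
    {F : SymMat n → ℝ} {Λ : ℝ} (hu : Continuous u)
    (hhom : ∀ (t : ℝ) (x : EuclideanSpace ℝ (Fin n)), 0 < t → u (t • x) = t ^ 2 * u x)
    (hsm : ∀ x ≠ 0, ContDiffAt ℝ 2 u x) (hF : IsUniformlyElliptic F Λ)
    (hz : ∀ x ≠ 0, F (hessian u x) = 0) : IsViscositySolution F Set.univ u := by
  obtain ⟨h1, hd, hell⟩ := hF
  have hΛ : 0 ≤ Λ⁻¹ := inv_nonneg.2 (by linarith)
  have hpos : ∀ A ξ, 0 ≤ fderiv ℝ F A (rankOne ξ) := fun A ξ =>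
    (mul_nonneg hΛ (sq_nonneg _)).trans (hell A ξ).1
  refine ⟨hu.continuousOn, fun x _ φ hφ hmax =>
    subsolution_of_homogeneous hu hhom hsm hd hpos (fun x hx => (hz x hx).ge) hφ hmax,
    fun x _ φ hφ hmin => ?_⟩
  have hd' : Differentiable ℝ fun A : SymMat n => -F (-A) := (Differentiable.comp (f := fun A : SymMat n => -A) hd differentiable_id.fun_neg).fun_neg
  have h := subsolution_of_homogeneous (u := fun y => -u y) (F := fun A => -F (-A))
    (φ := fun y => -φ y) (x := x) hu.neg (fun t x ht => by rw [hhom t x ht]; ring)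
    (fun x hx => (hsm x hx).neg) hd' (fun A ξ => ?_) (fun x hx => ?_) hφ.neg ?_
  · rw [hessian_neg, neg_neg] at h
    linarith
  · have : HasFDerivAt (fun A : SymMat n => -F (-A))
        (-((fderiv ℝ F (-A)).comp (-ContinuousLinearMap.id ℝ (SymMat n)))) A :=
      ((hd (-A)).hasFDerivAt.comp A (hasFDerivAt_id A).neg).neg
    rw [this.fderiv]
    simpa using hpos (-A) ξ
  · rw [hessian_neg, neg_neg, hz x hx, neg_zero]
  · have e : (fun y => -u y - -φ y) = fun y => -(u y - φ y) := by funext y; ring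
    rw [e]
    exact hmin.neg

theorem inner_smul_rankOne (c : ℝ) (A : SymMat n) (ξ : EuclideanSpace ℝ (Fin n)) :
    inner ℝ (c • A) (rankOne ξ) = c * inner ℝ A (rankOne ξ) := by
  rw [inner_rankOne, inner_rankOne, Finset.mul_sum]
  refine Finset.sum_congr rfl fun i _ => ?_
  rw [Finset.mul_sum]
  refine Finset.sum_congr rfl fun j _ => ?_
  rw [Submodule.coe_smul, PiLp.smul_apply, smul_eq_mul, mul_assoc]

/-- For a unit vector `e`, `c ⟨e, ξ⟩² ≤ c |ξ|²`, so the step `c • rankOne e` already gives the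
strict increase and monotonicity covers the rest. -/
theorem lt_of_hessian_add {F : SymMat n → ℝ} {Λ : ℝ} [NeZero n] (hF : IsUniformlyElliptic F Λ)
    (A : SymMat n) {c : ℝ} (hc : 0 < c) {B : SymMat n}
    (h : ∀ ξ, inner ℝ A (rankOne ξ) + c * ‖ξ‖ ^ 2 ≤ inner ℝ B (rankOne ξ)) : F A < F B := by
  obtain ⟨h1, hd, hell⟩ := hF
  have hΛ : 0 < Λ⁻¹ := inv_pos.2 (by linarith)
  have hpos : ∀ A ξ, 0 ≤ fderiv ℝ F A (rankOne ξ) := fun A ξ =>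
    (mul_nonneg hΛ.le (sq_nonneg _)).trans (hell A ξ).1
  let e : EuclideanSpace ℝ (Fin n) := EuclideanSpace.single 0 1
  have he : ‖e‖ = 1 := by simp [e]
  have hlt : F A < F (A + c • rankOne e) := by
    have hdv : ∀ t : ℝ, HasDerivAt (fun t : ℝ => F (A + t • rankOne e))
        (fderiv ℝ F (A + t • rankOne e) (rankOne e)) t := fun t => by
      have h1 : HasDerivAt (fun t : ℝ => A + t • rankOne e) (rankOne e) t := by
        simpa using ((hasDerivAt_id t).smul_const (rankOne e)).const_add A
      exact (hd _).hasFDerivAt.comp_hasDerivAt t h1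
    have hm : StrictMono fun t : ℝ => F (A + t • rankOne e) := by
      refine strictMono_of_deriv_pos fun t => ?_
      rw [(hdv t).deriv]
      refine lt_of_lt_of_le ?_ (hell _ _).1
      rw [he]; simpa using hΛ
    simpa using hm hc
  refine hlt.trans_le (SymMat.mono_of_fderiv_rankOne_nonneg hd hpos fun ξ => ?_)
  refine le_trans ?_ (h ξ)
  rw [inner_add_left, inner_smul_rankOne, inner_rankOne_rankOne]
  have h2 : inner ℝ e ξ ^ 2 ≤ ‖ξ‖ ^ 2 := by
    have := abs_real_inner_le_norm e ξ
    rw [he, one_mul] at this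
    exact sq_le_sq' (abs_le.1 this).1 (abs_le.1 this).2
  nlinarith

theorem le_of_subsolution {n : ℕ} [NeZero n] {u : EuclideanSpace ℝ (Fin n) → ℝ}
    {F : SymMat n → ℝ} {Λ : ℝ} (hF : IsUniformlyElliptic F Λ) (hu : Continuous u)
    (hsup : ∀ x, ∀ φ : EuclideanSpace ℝ (Fin n) → ℝ, ContDiffAt ℝ 2 φ x →
      IsLocalMin (fun y => u y - φ y) x → F (hessian φ x) ≤ 0)
    {G : Set (EuclideanSpace ℝ (Fin n))} (hG : IsOpen G) (hb : Bornology.IsBounded G)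
    {v : EuclideanSpace ℝ (Fin n) → ℝ} (hv : ContinuousOn v (closure G)) (hv2 : ContDiffOn ℝ 2 v G)
    (hsub : ∀ x ∈ G, 0 ≤ F (hessian v x)) (hfr : ∀ x ∈ frontier G, v x ≤ u x) :
    ∀ x ∈ G, v x ≤ u x := by
  intro x hx
  by_contra! hlt
  obtain ⟨R, hR⟩ := hb.closure.exists_norm_le
  have hR0 : 0 ≤ R := (norm_nonneg x).trans (hR x (subset_closure hx))
  -- On the closure `ε ‖y‖²` stays below half the gap at `x`, so the minimum of `u - φ` cannot lie
  -- on the frontier.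
  set ε := (v x - u x) / (2 * (R ^ 2 + 1)) with hε
  have hε0 : 0 < ε := div_pos (by linarith) (by positivity)
  have hεR : ε * (R ^ 2 + 1) = (v x - u x) / 2 := by
    rw [hε]; field_simp
  set φ : EuclideanSpace ℝ (Fin n) → ℝ := fun y => v y + ε * ‖y‖ ^ 2 with hφ
  have hcφ : ContinuousOn (fun y => u y - φ y) (closure G) :=
    hu.continuousOn.sub (hv.add (by fun_prop))
  obtain ⟨z, hz, hzm⟩ := hb.isCompact_closure.exists_isMinOn ⟨x, subset_closure hx⟩ hcφ
  have hzx : u z - φ z ≤ u x - φ x := hzm (subset_closure hx)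
  have hzG : z ∈ G := by
    by_contra hn
    have hfz := hfr z ⟨hz, by rwa [hG.interior_eq]⟩
    have : ‖z‖ ^ 2 ≤ R ^ 2 := pow_le_pow_left₀ (norm_nonneg z) (hR z hz) 2
    simp only [hφ] at hzx
    nlinarith [mul_le_mul_of_nonneg_left this hε0.le, mul_nonneg hε0.le (sq_nonneg ‖x‖)]
  have hvz : ContDiffAt ℝ 2 v z := hv2.contDiffAt (hG.mem_nhds hzG)
  let B : EuclideanSpace ℝ (Fin n) →L[ℝ] EuclideanSpace ℝ (Fin n) →L[ℝ] ℝ := (-ε) • innerCLM _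
  have hBe : (fun y => B y y) = fun y => -(ε * ‖y‖ ^ 2) := by
    funext y
    simp only [B, smul_apply, smul_eq_mul, innerCLM_apply, real_inner_self_eq_norm_sq]
    ring
  have hφe : φ = fun y => v y - B y y := by
    funext y
    have : B y y = -(ε * ‖y‖ ^ 2) := congrFun hBe y
    simp only [hφ, this]
    ring
  have hBc : ContDiffAt ℝ 2 (fun y => B y y) z := by fun_prop
  have hφz : ContDiffAt ℝ 2 φ z := by
    rw [hφe]
    exact hvz.sub hBc
  have hmin : IsLocalMin (fun y => u y - φ y) z := by
    filter_upwards [hG.mem_nhds hzG] with y hy using hzm (subset_closure hy)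
  have h1 := hsup z φ hφz hmin
  have h2 := lt_of_hessian_add hF (hessian v z) (c := 2 * ε) (by linarith) (B := hessian φ z)
    (fun ξ => by
      rw [inner_hessian_rankOne, inner_hessian_rankOne, hφe, fderiv_fderiv_sub_apply hvz hBc,
        fderiv_fderiv_quadratic]
      have : B ξ ξ = -(ε * ‖ξ‖ ^ 2) := congrFun hBe ξ
      rw [this]
      linarith)
  linarith [hsub z hzG]

theorem IsUniformlyElliptic.neg_comp_neg {F : SymMat n → ℝ} {Λ : ℝ} (hF : IsUniformlyElliptic F Λ) :
    IsUniformlyElliptic (fun A => -F (-A)) Λ := by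
  obtain ⟨h1, hd, hell⟩ := hF
  refine ⟨h1, (Differentiable.comp (f := fun A : SymMat n => -A) hd differentiable_id.fun_neg).fun_neg, fun A ξ => ?_⟩
  have : HasFDerivAt (fun A : SymMat n => -F (-A))
      (-((fderiv ℝ F (-A)).comp (-ContinuousLinearMap.id ℝ (SymMat n)))) A :=
    ((hd (-A)).hasFDerivAt.comp A (hasFDerivAt_id A).neg).neg
  rw [this.fderiv]
  simpa using hell (-A) ξ

/-- The second half is the first applied to `-u`, `-v` and the equally elliptic operator `A ↦ -F
(-A)`. -/
theorem IsViscositySolution.satisfiesMaximumPrinciple {n : ℕ} [NeZero n]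
    {u : EuclideanSpace ℝ (Fin n) → ℝ} {F : SymMat n → ℝ} {Λ : ℝ} (hF : IsUniformlyElliptic F Λ)
    (hu : IsViscositySolution F Set.univ u) : SatisfiesMaximumPrinciple F Set.univ u := by
  obtain ⟨hc, hsub, hsup⟩ := hu
  refine ⟨hc, fun G hG _ hb _ v hv hv2 => ⟨fun h1 h2 => ?_, fun h1 h2 x hx => ?_⟩⟩
  · exact le_of_subsolution hF (continuousOn_univ.1 hc) (fun x φ => hsup x (Set.mem_univ x) φ) hG hb
      hv hv2 h1 h2
  · have := le_of_subsolution hF.neg_comp_neg (u := fun y => -u y) (v := fun y => -v y)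
      (continuousOn_univ.1 hc).neg
      (fun x φ hφ hmin => ?_) hG hb hv.neg hv2.neg (fun x hx => ?_) (fun x hx => ?_) x hx
    · linarith
    · have h := hsub x (Set.mem_univ x) (fun y => -φ y) hφ.neg (by
        have e : (fun y => u y - -φ y) = fun y => -(-u y - φ y) := by funext y; ring
        rw [e]; exact hmin.neg)
      rw [hessian_neg] at h
      linarith
    · rw [hessian_neg, neg_neg]
      linarith [h1 x hx]
    · linarith [h2 x hx]

end Viscosity

/-! ### The cubic form on `ℝ¹²` and the second derivative of `w`. -/

section Blocks

/-- The first quaternionic coordinate of a point of `ℝ¹²`. -/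
noncomputable def quat₁ : EuclideanSpace ℝ (Fin 12) →ₗ[ℝ] Quaternion ℝ where
  toFun x := ⟨x 0, x 1, x 2, x 3⟩
  map_add' _ _ := rfl
  map_smul' _ _ := rfl

/-- The second quaternionic coordinate of a point of `ℝ¹²`. -/
noncomputable def quat₂ : EuclideanSpace ℝ (Fin 12) →ₗ[ℝ] Quaternion ℝ where
  toFun x := ⟨x 4, x 5, x 6, x 7⟩
  map_add' _ _ := rfl
  map_smul' _ _ := rfl

/-- The third quaternionic coordinate of a point of `ℝ¹²`. -/
noncomputable def quat₃ : EuclideanSpace ℝ (Fin 12) →ₗ[ℝ] Quaternion ℝ where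
  toFun x := ⟨x 8, x 9, x 10, x 11⟩
  map_add' _ _ := rfl
  map_smul' _ _ := rfl

theorem exists_quat_eq (h₁ h₂ h₃ : Quaternion ℝ) :
    ∃ h : EuclideanSpace ℝ (Fin 12), quat₁ h = h₁ ∧ quat₂ h = h₂ ∧ quat₃ h = h₃ :=
  ⟨!₂[h₁.re, h₁.imI, h₁.imJ, h₁.imK, h₂.re, h₂.imI, h₂.imJ, h₂.imK,
    h₃.re, h₃.imI, h₃.imJ, h₃.imK], rfl, rfl, rfl⟩

theorem inner_eq_quat (x y : EuclideanSpace ℝ (Fin 12)) :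
    inner ℝ x y = (quat₁ x * star (quat₁ y)).re + (quat₂ x * star (quat₂ y)).re
      + (quat₃ x * star (quat₃ y)).re := by
  have e : ∀ a b : Quaternion ℝ, (a * star b).re
      = a.re * b.re + a.imI * b.imI + a.imJ * b.imJ + a.imK * b.imK := fun a b => by
    simp only [Quaternion.re_mul, Quaternion.re_star, Quaternion.imI_star, Quaternion.imJ_star,
      Quaternion.imK_star]
    ring
  rw [e, e, e, PiLp.inner_apply]
  change _ = x 0 * y 0 + x 1 * y 1 + x 2 * y 2 + x 3 * y 3
    + (x 4 * y 4 + x 5 * y 5 + x 6 * y 6 + x 7 * y 7)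
    + (x 8 * y 8 + x 9 * y 9 + x 10 * y 10 + x 11 * y 11)
  simp only [Fin.sum_univ_succ, RCLike.inner_apply, conj_trivial]
  simp [Fin.succ]
  ring

theorem norm_sq_eq_quat (x : EuclideanSpace ℝ (Fin 12)) :
    ‖x‖ ^ 2 = ‖quat₁ x‖ ^ 2 + ‖quat₂ x‖ ^ 2 + ‖quat₃ x‖ ^ 2 := by
  rw [← real_inner_self_eq_norm_sq, inner_eq_quat, ← Quaternion.inner_def, ← Quaternion.inner_def,
    ← Quaternion.inner_def, real_inner_self_eq_norm_sq, real_inner_self_eq_norm_sq,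
    real_inner_self_eq_norm_sq]

/-- The cubic form `Re (ω₁ ω₂ ω₃)` on `ℝ¹²`. -/
noncomputable def tripleCubic (x : EuclideanSpace ℝ (Fin 12)) : ℝ :=
  (quat₁ x * quat₂ x * quat₃ x).re

/-- The quadratic form `½ D²P(x)(ξ, ξ)` of the cubic form `P = Re (ω₁ ω₂ ω₃)`. -/
noncomputable def tripleQuad (x ξ : EuclideanSpace ℝ (Fin 12)) : ℝ :=
  tripleForm (quat₁ x) (quat₂ x) (quat₃ x) (quat₁ ξ) (quat₂ ξ) (quat₃ ξ)

theorem quaternionicW_eq (x : EuclideanSpace ℝ (Fin 12)) :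
    quaternionicW x = tripleCubic x / ‖x‖ := rfl

theorem tripleCubic_smul (t : ℝ) (x : EuclideanSpace ℝ (Fin 12)) :
    tripleCubic (t • x) = t ^ 3 * tripleCubic x := by
  simp only [tripleCubic, map_smul, smul_mul_assoc, mul_smul_comm, Quaternion.re_smul, smul_eq_mul]
  ring

theorem tripleQuad_smul_left (t : ℝ) (x ξ : EuclideanSpace ℝ (Fin 12)) :
    tripleQuad (t • x) ξ = t * tripleQuad x ξ := by
  simp only [tripleQuad, tripleForm, map_smul, smul_mul_assoc, mul_smul_comm, Quaternion.re_smul,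
    smul_eq_mul]
  ring

theorem tripleQuad_smul_right (t : ℝ) (x ξ : EuclideanSpace ℝ (Fin 12)) :
    tripleQuad x (t • ξ) = t ^ 2 * tripleQuad x ξ := by
  simp only [tripleQuad, tripleForm, map_smul, smul_mul_assoc, mul_smul_comm, Quaternion.re_smul,
    smul_eq_mul]
  ring

theorem tripleQuad_sub_left (x y ξ : EuclideanSpace ℝ (Fin 12)) :
    tripleQuad (x - y) ξ = tripleQuad x ξ - tripleQuad y ξ := by
  simp only [tripleQuad, tripleForm, map_sub, sub_mul, mul_sub, Quaternion.re_sub]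
  ring

theorem tripleQuad_self (x : EuclideanSpace ℝ (Fin 12)) : tripleQuad x x = 3 * tripleCubic x := by
  simp only [tripleQuad, tripleForm, tripleCubic]
  ring

theorem tripleCubic_line (x ξ : EuclideanSpace ℝ (Fin 12)) (t : ℝ) :
    tripleCubic (x + t • ξ) = tripleCubic x + t * tripleQuad ξ x + t ^ 2 * tripleQuad x ξ
      + t ^ 3 * tripleCubic ξ := by
  simp only [tripleCubic, tripleQuad, tripleForm, map_add, map_smul, add_mul, mul_add,
    smul_mul_assoc, mul_smul_comm, Quaternion.re_add, Quaternion.re_smul, smul_eq_mul]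
  ring

theorem contDiff_tripleCubic : ContDiff ℝ ∞ tripleCubic := by
  have : tripleCubic = fun x => 
     ((x 0 * x 4 - x 1 * x 5 - x 2 * x 6 - x 3 * x 7) * x 8
    - (x 0 * x 5 + x 1 * x 4 + x 2 * x 7 - x 3 * x 6) * x 9
    - (x 0 * x 6 - x 1 * x 7 + x 2 * x 4 + x 3 * x 5) * x 10
    - (x 0 * x 7 + x 1 * x 6 - x 2 * x 5 + x 3 * x 4) * x 11) := by
    funext x
    simp only [tripleCubic, Quaternion.re_mul, Quaternion.imI_mul, Quaternion.imJ_mul,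
      Quaternion.imK_mul]
    rfl
  rw [this]
  fun_prop

theorem contDiffAt_quaternionicW {x : EuclideanSpace ℝ (Fin 12)} (hx : x ≠ 0) :
    ContDiffAt ℝ ∞ quaternionicW x :=
  contDiff_tripleCubic.contDiffAt.div (contDiffAt_norm ℝ hx) (norm_ne_zero_iff.2 hx)

theorem quaternionicW_smul (t : ℝ) (x : EuclideanSpace ℝ (Fin 12)) (ht : 0 < t) :
    quaternionicW (t • x) = t ^ 2 * quaternionicW x := by
  rw [quaternionicW_eq, quaternionicW_eq, tripleCubic_smul, norm_smul, Real.norm_of_nonneg ht.le]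
  field_simp

theorem abs_tripleCubic_le (x : EuclideanSpace ℝ (Fin 12)) : |tripleCubic x| ≤ ‖x‖ ^ 3 := by
  have h := norm_sq_eq_quat x
  have hle : ∀ q : ℝ, 0 ≤ q → q ^ 2 ≤ ‖x‖ ^ 2 → q ≤ ‖x‖ := fun q hq h =>
    (pow_le_pow_iff_left₀ hq (norm_nonneg x) two_ne_zero).1 h
  have h1 := hle _ (norm_nonneg (quat₁ x)) (by nlinarith [sq_nonneg ‖quat₂ x‖, sq_nonneg ‖quat₃ x‖])
  have h2 := hle _ (norm_nonneg (quat₂ x)) (by nlinarith [sq_nonneg ‖quat₁ x‖, sq_nonneg ‖quat₃ x‖])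
  have h3 := hle _ (norm_nonneg (quat₃ x)) (by nlinarith [sq_nonneg ‖quat₂ x‖, sq_nonneg ‖quat₁ x‖])
  refine (abs_re_mul_mul_le _ _ _).trans ?_
  calc ‖quat₁ x‖ * (‖quat₂ x‖ * ‖quat₃ x‖) ≤ ‖x‖ * (‖x‖ * ‖x‖) := by gcongr
    _ = ‖x‖ ^ 3 := by ring

theorem continuous_quaternionicW : Continuous quaternionicW := by
  rw [continuous_iff_continuousAt]
  intro x
  rcases ne_or_eq x 0 with hx | rfl
  · exact (contDiffAt_quaternionicW hx).continuousAt
  have h0 : quaternionicW 0 = 0 := by simp [quaternionicW_eq]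
  rw [ContinuousAt, h0]
  refine squeeze_zero_norm (a := fun x => ‖x‖ ^ 2) (fun x => ?_) ?_
  · rw [quaternionicW_eq, norm_div, norm_norm, Real.norm_eq_abs]
    rcases (norm_nonneg x).eq_or_lt with h | h
    · rw [← h]; simp
    · rw [div_le_iff₀ h]
      refine (abs_tripleCubic_le x).trans_eq (by ring)
  · have : Continuous fun x : EuclideanSpace ℝ (Fin 12) => ‖x‖ ^ 2 := by fun_prop
    simpa using this.tendsto 0

/-- Along a line the numerator is an explicit cubic polynomial and the norm is the square root of a
quadratic, so this is one-variable calculus. -/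
theorem fderiv_fderiv_quaternionicW {x : EuclideanSpace ℝ (Fin 12)} (hx : x ≠ 0)
    (ξ : EuclideanSpace ℝ (Fin 12)) :
    fderiv ℝ (fderiv ℝ quaternionicW) x ξ ξ = 2 * tripleQuad x ξ / ‖x‖
      - 2 * tripleQuad ξ x * inner ℝ x ξ / ‖x‖ ^ 3 - tripleCubic x * ‖ξ‖ ^ 2 / ‖x‖ ^ 3
      + 3 * tripleCubic x * inner ℝ x ξ ^ 2 / ‖x‖ ^ 5 := by
  have hx0 : 0 < ‖x‖ := norm_pos_iff.2 hx
  set r : ℝ → ℝ := fun t => ‖x + t • ξ‖ with hr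
  set p : ℝ → ℝ := fun t => tripleCubic x + t * tripleQuad ξ x + t ^ 2 * tripleQuad x ξ
      + t ^ 3 * tripleCubic ξ with hp
  set p' : ℝ → ℝ := fun t => tripleQuad ξ x + 2 * t * tripleQuad x ξ
      + 3 * t ^ 2 * tripleCubic ξ with hp'
  have hpd : ∀ t, HasDerivAt p (p' t) t := fun t => by
    have := (hasDerivAt_quadratic (tripleCubic x) (tripleQuad ξ x) (tripleQuad x ξ) t).fun_add
      (((hasDerivAt_id' t).fun_pow 3).mul_const (tripleCubic ξ))
    exact this.congr_deriv (by simp [hp'])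
  have hpd' : HasDerivAt p' (2 * tripleQuad x ξ) 0 := by
    have := hasDerivAt_quadratic (tripleQuad ξ x) (2 * tripleQuad x ξ) (3 * tripleCubic ξ) 0
    refine (this.congr_deriv (by ring)).congr_of_eventuallyEq (Eventually.of_forall fun t => ?_)
    simp only [hp']; ring
  have hrc : ContinuousAt r 0 := by
    have : Continuous r := by fun_prop
    exact this.continuousAt
  have hr0 : r 0 = ‖x‖ := by simp [hr]
  have hpos : ∀ᶠ t in 𝓝 (0 : ℝ), 0 < r t := hrc.eventually (lt_mem_nhds (by rw [hr0]; exact hx0))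
  have hrd : ∀ t, 0 < r t → HasDerivAt r ((inner ℝ x ξ + t * ‖ξ‖ ^ 2) / r t) t := by
    intro t ht
    have e : r = fun t => √(‖x‖ ^ 2 + t * (2 * inner ℝ x ξ) + t ^ 2 * ‖ξ‖ ^ 2) := by
      funext s
      rw [hr]
      simp only
      rw [← Real.sqrt_sq (norm_nonneg (x + s • ξ)), norm_add_sq_real, norm_smul, mul_pow,
        real_inner_smul_right, Real.norm_eq_abs, sq_abs]
      congr 1; ring
    have e' : ‖x‖ ^ 2 + t * (2 * inner ℝ x ξ) + t ^ 2 * ‖ξ‖ ^ 2 ≠ 0 := by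
      intro h
      rw [e] at ht
      simp only at ht
      rw [h, Real.sqrt_zero] at ht
      exact lt_irrefl _ ht
    have := (hasDerivAt_quadratic (‖x‖ ^ 2) (2 * inner ℝ x ξ) (‖ξ‖ ^ 2) t).sqrt e'
    rw [← congrFun e t, ← e] at this
    refine this.congr_deriv ?_
    field_simp
  refine fderiv_fderiv_eq_of_line ((contDiffAt_quaternionicW hx).of_le (by norm_cast))
    (g := fun t => p' t / r t - p t * (inner ℝ x ξ + t * ‖ξ‖ ^ 2) / r t ^ 3) ?_ ?_
  · filter_upwards [hpos] with t ht
    have := (hpd t).fun_div (hrd t ht) ht.ne'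
    refine (this.congr_deriv ?_).congr_of_eventuallyEq (Eventually.of_forall fun s => ?_)
    · field_simp
    · change quaternionicW (x + s • ξ) = _
      rw [quaternionicW_eq, tripleCubic_line]
  · have h1 : HasDerivAt (fun t : ℝ => inner ℝ x ξ + t * ‖ξ‖ ^ 2) (‖ξ‖ ^ 2) 0 := by
      have := hasDerivAt_quadratic (inner ℝ x ξ) (‖ξ‖ ^ 2) 0 0
      simpa using this
    have hr3 := (hrd 0 (by rw [hr0]; exact hx0)).fun_pow 3
    have hr1 := hrd 0 (by rw [hr0]; exact hx0)
    have := (hpd'.fun_div hr1 (by rw [hr0]; exact hx0.ne')).fun_sub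
      (((hpd 0).fun_mul h1).fun_div hr3 (by rw [hr0]; positivity))
    refine this.congr_deriv ?_
    simp only [hr0, hp, hp', zero_mul, add_zero, mul_zero, ne_eq, OfNat.ofNat_ne_zero,
      not_false_eq_true, zero_pow]
    field_simp
    ring

end Blocks

/-! ### The Hessian map of `w`. -/

section Hessian

theorem contDiffAt_hessian {n : ℕ} {u : EuclideanSpace ℝ (Fin n) → ℝ}
    {x : EuclideanSpace ℝ (Fin n)} (hu : ContDiffAt ℝ ∞ u x) : ContDiffAt ℝ ∞ (hessian u) x := by
  let e : Fin n → EuclideanSpace ℝ (Fin n) := fun i => EuclideanSpace.single i 1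
  let L : (EuclideanSpace ℝ (Fin n) →L[ℝ] EuclideanSpace ℝ (Fin n) →L[ℝ] ℝ) →ₗ[ℝ] SymMat n :=
    { toFun := fun B => ⟨WithLp.toLp 2 fun p => (B (e p.1) (e p.2) + B (e p.2) (e p.1)) / 2,
        fun i j => by simp only [add_comm]⟩
      map_add' := fun A B => by
        ext p
        simp
        ring
      map_smul' := fun c A => by
        ext p
        simp
        ring }
  have h1 : ContDiffAt ℝ ∞ (fderiv ℝ u) x := hu.fderiv_right (m := ∞) (by norm_cast)
  have h2 : ContDiffAt ℝ ∞ (fderiv ℝ (fderiv ℝ u)) x := h1.fderiv_right (m := ∞) (by norm_cast)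
  exact L.toContinuousLinearMap.contDiff.contDiffAt.comp x h2

theorem inner_hessian_quaternionicW {x : EuclideanSpace ℝ (Fin 12)} (hx : ‖x‖ = 1)
    (ξ : EuclideanSpace ℝ (Fin 12)) :
    inner ℝ (hessian quaternionicW x) (rankOne ξ) = 2 * tripleQuad x ξ
      - 2 * tripleQuad ξ x * inner ℝ x ξ - tripleCubic x * ‖ξ‖ ^ 2
      + 3 * tripleCubic x * inner ℝ x ξ ^ 2 := by
  have hx0 : x ≠ 0 := by
    rintro rfl
    simp at hx
  rw [inner_hessian_rankOne, fderiv_fderiv_quaternionicW hx0, hx]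
  ring

theorem hessian_quaternionicW_smul {t : ℝ} (ht : 0 < t) {x : EuclideanSpace ℝ (Fin 12)}
    (hx : x ≠ 0) : hessian quaternionicW (t • x) = hessian quaternionicW x := by
  refine SymMat.ext_rankOne fun ξ => ?_
  have hx0 : 0 < ‖x‖ := norm_pos_iff.2 hx
  rw [inner_hessian_rankOne, inner_hessian_rankOne, fderiv_fderiv_quaternionicW hx,
    fderiv_fderiv_quaternionicW (smul_ne_zero ht.ne' hx), norm_smul, Real.norm_of_nonneg ht.le,
    tripleQuad_smul_left, tripleQuad_smul_right, tripleCubic_smul, real_inner_smul_left]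
  field_simp

/-- A basis vector lies in one quaternionic block and every term of the form uses two; summed over
`i`, this is harmonicity of `P`. -/
theorem tripleQuad_single (x : EuclideanSpace ℝ (Fin 12)) (i : Fin 12) :
    tripleQuad x (EuclideanSpace.single i 1) = 0 := by
  have h : (quat₁ (EuclideanSpace.single i 1) = 0 ∧ quat₂ (EuclideanSpace.single i 1) = 0) ∨
      (quat₁ (EuclideanSpace.single i 1) = 0 ∧ quat₃ (EuclideanSpace.single i 1) = 0) ∨
      (quat₂ (EuclideanSpace.single i 1) = 0 ∧ quat₃ (EuclideanSpace.single i 1) = 0) := by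
    have h1 : 3 < i.val → quat₁ (EuclideanSpace.single i 1) = 0 := fun h => by
      have : ∀ j : Fin 12, j.val ≤ 3 → EuclideanSpace.single i (1 : ℝ) j = 0 := fun j hj => by
        rw [PiLp.single_apply, if_neg (by rintro rfl; omega)]
      exact Quaternion.ext _ _ (this 0 (by decide)) (this 1 (by decide)) (this 2 (by decide))
        (this 3 (by decide))
    have h2 : i.val ≤ 3 ∨ 7 < i.val → quat₂ (EuclideanSpace.single i 1) = 0 := fun h => by
      have : ∀ j : Fin 12, 3 < j.val ∧ j.val ≤ 7 → EuclideanSpace.single i (1 : ℝ) j = 0 :=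
        fun j hj => by rw [PiLp.single_apply, if_neg (by rintro rfl; omega)]
      exact Quaternion.ext _ _ (this 4 (by decide)) (this 5 (by decide)) (this 6 (by decide))
        (this 7 (by decide))
    have h3 : i.val ≤ 7 → quat₃ (EuclideanSpace.single i 1) = 0 := fun h => by
      have : ∀ j : Fin 12, 7 < j.val → EuclideanSpace.single i (1 : ℝ) j = 0 := fun j hj => by
        rw [PiLp.single_apply, if_neg (by rintro rfl; omega)]
      exact Quaternion.ext _ _ (this 8 (by decide)) (this 9 (by decide)) (this 10 (by decide))
        (this 11 (by decide))
    rcases le_or_gt i.val 3 with h | h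
    · exact Or.inr (Or.inr ⟨h2 (Or.inl h), h3 (by omega)⟩)
    · rcases le_or_gt i.val 7 with h' | h'
      · exact Or.inr (Or.inl ⟨h1 h, h3 h'⟩)
      · exact Or.inl ⟨h1 h, h2 (Or.inr h')⟩
  rw [tripleQuad, tripleForm]
  rcases h with ⟨a, b⟩ | ⟨a, b⟩ | ⟨a, b⟩ <;> rw [a, b] <;>
    simp only [zero_mul, mul_zero] <;> exact (by change (0 : ℝ) + 0 + 0 = 0; norm_num)

/-- Euler's identity for the cubic `P`. -/
theorem sum_tripleQuad_single (x : EuclideanSpace ℝ (Fin 12)) :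
    ∑ i, tripleQuad (EuclideanSpace.single i 1) x * x i = 3 * tripleCubic x := by
  let L : EuclideanSpace ℝ (Fin 12) →ₗ[ℝ] ℝ :=
    { toFun := fun y => tripleQuad y x
      map_add' := fun y z => by
        simp only [tripleQuad, tripleForm, map_add, add_mul, mul_add, Quaternion.re_add]
        ring
      map_smul' := fun t y => tripleQuad_smul_left t y x }
  have hx : x = ∑ i, x i • EuclideanSpace.single i (1 : ℝ) := by
    ext j
    simp [WithLp.ofLp_sum, Finset.sum_apply, Pi.single_apply]
  have h : L x = ∑ i, x i * L (EuclideanSpace.single i 1) := by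
    conv_lhs => rw [hx]
    simp only [map_sum, map_smul, smul_eq_mul]
  rw [← tripleQuad_self]
  refine Eq.trans (Finset.sum_congr rfl fun i _ => ?_) h.symm
  rw [mul_comm]
  rfl

end Hessian

/-! ### The extremal operator: sublinear, Lipschitz and uniformly elliptic. -/

section Pucci
variable {n : ℕ}

/-- The trace of a symmetric matrix. -/
noncomputable def SymMat.tr (A : SymMat n) : ℝ := ∑ i, inner ℝ A (rankOne (EuclideanSpace.single i 1))

theorem inner_rankOne_smul (A : SymMat n) (c : ℝ) (ξ : EuclideanSpace ℝ (Fin n)) :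
    inner ℝ A (rankOne (c • ξ)) = c ^ 2 * inner ℝ A (rankOne ξ) := by
  simp only [inner_rankOne, PiLp.smul_apply, smul_eq_mul, Finset.mul_sum]
  exact Finset.sum_congr rfl fun i _ => Finset.sum_congr rfl fun j _ => by ring

/-- The maximum of `A ξ · ξ` over the unit ball. -/
noncomputable def SymMat.maxQuad (A : SymMat n) : ℝ :=
  ⨆ h : Metric.closedBall (0 : EuclideanSpace ℝ (Fin n)) 1, inner ℝ A (rankOne h.1)

theorem SymMat.tr_add (A B : SymMat n) : SymMat.tr (A + B) = SymMat.tr A + SymMat.tr B := by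
  simp only [SymMat.tr, inner_add_left, Finset.sum_add_distrib]

theorem SymMat.tr_sub (A B : SymMat n) : SymMat.tr (A - B) = SymMat.tr A - SymMat.tr B := by
  simp only [SymMat.tr, inner_sub_left, Finset.sum_sub_distrib]

theorem SymMat.tr_rankOne (ξ : EuclideanSpace ℝ (Fin n)) : SymMat.tr (rankOne ξ) = ‖ξ‖ ^ 2 := by
  simp only [SymMat.tr, inner_rankOne_rankOne]
  rw [EuclideanSpace.real_norm_sq_eq]
  refine Finset.sum_congr rfl fun i _ => ?_
  rw [EuclideanSpace.inner_single_right]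
  simp

theorem inner_rankOne_le (A : SymMat n) (ξ : EuclideanSpace ℝ (Fin n)) :
    inner ℝ A (rankOne ξ) ≤ ‖A‖ * ‖ξ‖ ^ 2 := by
  rw [← norm_rankOne]
  exact real_inner_le_norm _ _

theorem SymMat.tr_le (A : SymMat n) : SymMat.tr A ≤ n * ‖A‖ := by
  calc SymMat.tr A ≤ ∑ _i : Fin n, ‖A‖ := Finset.sum_le_sum fun i _ => by
        simpa using inner_rankOne_le A (EuclideanSpace.single i 1)
    _ = n * ‖A‖ := by simp

theorem SymMat.inner_le_norm_of_mem (A : SymMat n)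
    (h : Metric.closedBall (0 : EuclideanSpace ℝ (Fin n)) 1) : inner ℝ A (rankOne h.1) ≤ ‖A‖ := by
  have h1 : ‖h.1‖ ≤ 1 := mem_closedBall_zero_iff.1 h.2
  refine (inner_rankOne_le A h.1).trans ?_
  have : ‖h.1‖ ^ 2 ≤ 1 := by nlinarith [norm_nonneg h.1]
  nlinarith [norm_nonneg A]

theorem SymMat.bddAbove_quad (A : SymMat n) : BddAbove (Set.range
    fun h : Metric.closedBall (0 : EuclideanSpace ℝ (Fin n)) 1 => inner ℝ A (rankOne h.1)) :=
  ⟨‖A‖, by rintro _ ⟨h, rfl⟩; exact SymMat.inner_le_norm_of_mem A h⟩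

instance : Nonempty (Metric.closedBall (0 : EuclideanSpace ℝ (Fin n)) 1) :=
  ⟨⟨0, by simp⟩⟩

theorem SymMat.le_maxQuad (A : SymMat n) {h : EuclideanSpace ℝ (Fin n)} (hh : ‖h‖ ≤ 1) :
    inner ℝ A (rankOne h) ≤ SymMat.maxQuad A :=
  le_ciSup (SymMat.bddAbove_quad A) ⟨h, by simpa using hh⟩

theorem SymMat.maxQuad_le_norm (A : SymMat n) : SymMat.maxQuad A ≤ ‖A‖ :=
  ciSup_le fun h => SymMat.inner_le_norm_of_mem A h

theorem SymMat.maxQuad_add_le (A B : SymMat n) : SymMat.maxQuad (A + B) ≤ SymMat.maxQuad A + SymMat.maxQuad B :=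
  ciSup_le fun h => by
    have h1 : ‖h.1‖ ≤ 1 := mem_closedBall_zero_iff.1 h.2
    rw [inner_add_left]
    exact add_le_add (SymMat.le_maxQuad A h1) (SymMat.le_maxQuad B h1)

theorem SymMat.maxQuad_le_maxQuad_add_rankOne (A : SymMat n) (ξ : EuclideanSpace ℝ (Fin n)) :
    SymMat.maxQuad A ≤ SymMat.maxQuad (A + rankOne ξ) :=
  ciSup_le fun h => by
    have h1 : ‖h.1‖ ≤ 1 := mem_closedBall_zero_iff.1 h.2
    refine le_trans ?_ (SymMat.le_maxQuad (A + rankOne ξ) h1)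
    rw [inner_add_left, inner_rankOne_rankOne]
    nlinarith [sq_nonneg (inner ℝ ξ h.1)]

/-- The extremal operator `tr A + κ max_{|ξ| ≤ 1} A ξ · ξ`. -/
noncomputable def SymMat.extremal (κ : ℝ) (A : SymMat n) : ℝ := SymMat.tr A + κ * SymMat.maxQuad A

theorem SymMat.extremal_add_le {κ : ℝ} (hκ : 0 ≤ κ) (A B : SymMat n) :
    SymMat.extremal κ (A + B) ≤ SymMat.extremal κ A + SymMat.extremal κ B := by
  have := mul_le_mul_of_nonneg_left (SymMat.maxQuad_add_le A B) hκ
  simp only [SymMat.extremal, SymMat.tr_add]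
  linarith

theorem SymMat.extremal_le {κ : ℝ} (hκ : 0 ≤ κ) (A : SymMat n) :
    SymMat.extremal κ A ≤ (n + κ) * ‖A‖ := by
  have := mul_le_mul_of_nonneg_left (SymMat.maxQuad_le_norm A) hκ
  rw [SymMat.extremal]
  linarith [SymMat.tr_le A]

theorem SymMat.le_extremal_add_rankOne {κ : ℝ} (hκ : 0 ≤ κ) (A : SymMat n)
    (ξ : EuclideanSpace ℝ (Fin n)) :
    SymMat.extremal κ A + ‖ξ‖ ^ 2 ≤ SymMat.extremal κ (A + rankOne ξ) := by
  have := mul_le_mul_of_nonneg_left (SymMat.maxQuad_le_maxQuad_add_rankOne A ξ) hκ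
  simp only [SymMat.extremal, SymMat.tr_add, SymMat.tr_rankOne]
  linarith

theorem SymMat.extremal_add_rankOne_le {κ : ℝ} (hκ : 0 ≤ κ) (A : SymMat n)
    (ξ : EuclideanSpace ℝ (Fin n)) :
    SymMat.extremal κ (A + rankOne ξ) ≤ SymMat.extremal κ A + (1 + κ) * ‖ξ‖ ^ 2 := by
  refine (SymMat.extremal_add_le hκ A _).trans ?_
  have := mul_le_mul_of_nonneg_left (SymMat.maxQuad_le_norm (rankOne ξ)) hκ
  rw [norm_rankOne] at this
  have e : SymMat.extremal κ (rankOne ξ) = ‖ξ‖ ^ 2 + κ * SymMat.maxQuad (rankOne ξ) := by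
    rw [SymMat.extremal, SymMat.tr_rankOne]
  linarith

end Pucci

/-! ### Separation of the Hessians of `w` on the unit sphere. -/

theorem tr_hessian_quaternionicW {x : EuclideanSpace ℝ (Fin 12)} (hx : ‖x‖ = 1) :
    SymMat.tr (hessian quaternionicW x) = -15 * tripleCubic x := by
  have e : ∀ i, inner ℝ (hessian quaternionicW x) (rankOne (EuclideanSpace.single i 1))
      = -2 * (tripleQuad (EuclideanSpace.single i 1) x * x i) - tripleCubic x
        + 3 * tripleCubic x * x i ^ 2 := by
    intro i
    rw [inner_hessian_quaternionicW hx, tripleQuad_single, EuclideanSpace.inner_single_right]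
    simp
    ring
  have hs : ∑ i, x i ^ 2 = 1 := by
    rw [← EuclideanSpace.real_norm_sq_eq, hx, one_pow]
  simp only [SymMat.tr, e, Finset.sum_add_distrib, Finset.sum_sub_distrib, ← Finset.mul_sum,
    sum_tripleQuad_single, hs]
  simp
  ring

theorem norm_sub_le_extremal {a b : EuclideanSpace ℝ (Fin 12)} (ha : ‖a‖ = 1) (hb : ‖b‖ = 1) :
    ‖a - b‖ ≤ SymMat.extremal (2 * 10 ^ 5) (hessian quaternionicW a - hessian quaternionicW b) := by
  rcases eq_or_ne a b with rfl | hne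
  · have h0 : SymMat.extremal (2 * 10 ^ 5) ((0 : SymMat 12)) = 0 := by
      simp [SymMat.extremal, SymMat.tr, SymMat.maxQuad]
    rw [sub_self, sub_self, h0, norm_zero]
  have hd : 0 < ‖a - b‖ := norm_pos_iff.2 (sub_ne_zero.2 hne)
  have hd2 := norm_sq_eq_quat (a - b)
  simp only [map_sub] at hd2
  obtain ⟨δ, h3, hδ, hμ, h₁, h₂, h₃, hpos, oa, ob, hM⟩ :=
    exists_chord_direction (a₁ := quat₁ a) (a₂ := quat₂ a) (a₃ := quat₃ a) (b₁ := quat₁ b)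
      (b₂ := quat₂ b) (b₃ := quat₃ b) (by rw [← norm_sq_eq_quat, ha, one_pow])
      (by rw [← norm_sq_eq_quat, hb, one_pow]) (by rw [← hd2]; positivity)
  obtain ⟨h, rfl, rfl, rfl⟩ := exists_quat_eq h₁ h₂ h₃
  rw [← norm_sq_eq_quat] at hpos hM
  rw [← inner_eq_quat] at oa ob
  rw [← hd2] at h3
  have hh : 0 < ‖h‖ := by
    rcases (norm_nonneg h).eq_or_lt with h0 | h0
    · rw [← h0] at hpos; norm_num at hpos
    · exact h0
  -- Since `h` is orthogonal to both `a` and `b`, every term with an inner product drops out.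
  have e : inner ℝ (hessian quaternionicW a - hessian quaternionicW b) (rankOne h)
      = 2 * tripleQuad (a - b) h - (tripleCubic a - tripleCubic b) * ‖h‖ ^ 2 := by
    rw [inner_sub_left, inner_hessian_quaternionicW ha, inner_hessian_quaternionicW hb, oa, ob,
      tripleQuad_sub_left]
    ring
  have hq : δ / 10 ^ 4 ≤ SymMat.maxQuad (hessian quaternionicW a - hessian quaternionicW b) := by
    have hn : ‖(‖h‖⁻¹ : ℝ) • h‖ ≤ 1 := by
      rw [norm_smul, norm_inv, norm_norm, inv_mul_cancel₀ hh.ne']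
    refine le_trans ?_ (SymMat.le_maxQuad _ hn)
    rw [inner_rankOne_smul, e]
    have : δ / 10 ^ 4 * ‖h‖ ^ 2
        ≤ 2 * tripleQuad (a - b) h - (tripleCubic a - tripleCubic b) * ‖h‖ ^ 2 := by
      have : 2 * tripleForm (quat₁ a - quat₁ b) (quat₂ a - quat₂ b) (quat₃ a - quat₃ b)
          (quat₁ h) (quat₂ h) (quat₃ h) = 2 * tripleQuad (a - b) h := by
        simp only [tripleQuad, map_sub]
      rw [this] at hM
      change (tripleCubic a - tripleCubic b + δ / 10 ^ 4) * ‖h‖ ^ 2 ≤ _ at hM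
      linarith
    rw [inv_pow]
    rw [inv_mul_eq_div, le_div_iff₀ (by positivity)]
    exact this
  -- The trace costs at most `15 δ` and the maximum contributes at least `2 * 10 ^ 5 * (δ / 10 ^ 4)
  -- = 20 δ`; the remaining `5 δ` exceeds `2 δ ≥ ‖a - b‖`.
  rw [SymMat.extremal, SymMat.tr_sub, tr_hessian_quaternionicW ha, tr_hessian_quaternionicW hb]
  have hμ' : tripleCubic a - tripleCubic b ≤ δ := hμ
  have hle : ‖a - b‖ ≤ 2 * δ := abs_le_of_sq_le_sq' (by nlinarith) (by linarith) |>.2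
  linarith

/-! ### Second differences of a smooth map. -/

section SecondDifference

variable {V Q : Type*} [NormedAddCommGroup V] [NormedSpace ℝ V] [NormedAddCommGroup Q]
  [NormedSpace ℝ Q]

/-- The mean value inequality twice: for `fderiv ℝ T` over the shift `y - x`, then for the first
difference between `z` and `x`. -/
theorem norm_second_difference_le {T : V → Q} {x y z : V} {r M : ℝ}
    (hT : ∀ u ∈ Metric.ball x (2 * r), ContDiffAt ℝ 2 T u)
    (hM : ∀ u ∈ Metric.ball x (2 * r), ‖fderiv ℝ (fderiv ℝ T) u‖ ≤ M)
    (hy : ‖y - x‖ < r) (hz : ‖z - x‖ < r) :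
    ‖(T y - T x) - (T (z + (y - x)) - T z)‖ ≤ M * ‖y - x‖ * ‖x - z‖ := by
  have hr : 0 < r := (norm_nonneg _).trans_lt hy
  have hsub : ∀ u ∈ Metric.ball x r, u ∈ Metric.ball x (2 * r) := fun u hu =>
    Metric.ball_subset_ball (by linarith) hu
  have hadd : ∀ u ∈ Metric.ball x r, u + (y - x) ∈ Metric.ball x (2 * r) := fun u hu => by
    rw [mem_ball_iff_norm] at hu ⊢
    calc ‖u + (y - x) - x‖ = ‖(u - x) + (y - x)‖ := by congr 1; abel
      _ ≤ ‖u - x‖ + ‖y - x‖ := norm_add_le _ _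
      _ < 2 * r := by linarith
  have hlip : ∀ u ∈ Metric.ball x r, ‖fderiv ℝ T (u + (y - x)) - fderiv ℝ T u‖ ≤ M * ‖y - x‖ := by
    intro u hu
    have := (convex_ball x (2 * r)).norm_image_sub_le_of_norm_fderiv_le (f := fderiv ℝ T)
      (fun w hw => ((hT w hw).fderiv_right (m := 1) (by norm_num)).differentiableAt (by norm_num))
      hM (hsub u hu) (hadd u hu)
    simpa using this
  have hd : ∀ u ∈ Metric.ball x r, HasFDerivAt (fun u => T (u + (y - x)) - T u)
      (fderiv ℝ T (u + (y - x)) - fderiv ℝ T u) u := fun u hu => by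
    have h1 := ((hT _ (hadd u hu)).differentiableAt (by norm_num)).hasFDerivAt
    have h2 := ((hT _ (hsub u hu)).differentiableAt (by norm_num)).hasFDerivAt
    exact ((hasFDerivAt_comp_add_right (y - x)).2 h1).sub h2
  have := (convex_ball x r).norm_image_sub_le_of_norm_hasFDerivWithin_le
    (f := fun u => T (u + (y - x)) - T u) (fun u hu => (hd u hu).hasFDerivWithinAt) hlip
    (mem_ball_iff_norm.2 hz) (Metric.mem_ball_self hr)
  simpa using this

theorem exists_norm_second_difference_le [FiniteDimensional ℝ V] {T : V → Q}
    (hT : ∀ x, x ≠ 0 → ContDiffAt ℝ ∞ T x) :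
    ∃ M, 0 ≤ M ∧ ∀ x y z : V, 1 / 2 ≤ ‖x‖ → ‖x‖ ≤ 2 → ‖y - x‖ < 1 / 8 → ‖z - x‖ < 1 / 8 →
      ‖(T y - T x) - (T (z + (y - x)) - T z)‖ ≤ M * ‖y - x‖ * ‖x - z‖ := by
  let S : Set V := Metric.closedBall 0 3 \ Metric.ball 0 (1 / 4)
  have hS : IsCompact S := (isCompact_closedBall 0 3).diff Metric.isOpen_ball
  have hS0 : ∀ x ∈ S, x ≠ 0 := by
    rintro x hx rfl
    exact hx.2 (Metric.mem_ball_self (by norm_num))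
  have hc : ContinuousOn (fun u => fderiv ℝ (fderiv ℝ T) u) S := fun x hx =>
    (((hT x (hS0 x hx)).fderiv_right (m := ∞) (by norm_cast)).fderiv_right
      (m := ∞) (by norm_cast)).continuousAt.continuousWithinAt
  obtain ⟨M, hM⟩ := hS.exists_bound_of_continuousOn (f := fun u => fderiv ℝ (fderiv ℝ T) u) hc
  refine ⟨max M 0, le_max_right _ _, fun x y z hx1 hx2 hy hz => ?_⟩
  have hb : ∀ u ∈ Metric.ball x (2 * (1 / 8)), u ∈ S := fun u hu => by
    rw [mem_ball_iff_norm] at hu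
    have h1 := norm_sub_norm_le u x
    have h2 := norm_sub_norm_le x u
    rw [norm_sub_rev] at h2
    refine ⟨mem_closedBall_zero_iff.2 (by linarith), fun h => ?_⟩
    rw [mem_ball_zero_iff] at h
    linarith
  exact norm_second_difference_le (fun u hu => (hT u (hS0 u (hb u hu))).of_le (by norm_cast))
    (fun u hu => (hM u (hb u hu)).trans (le_max_left _ _)) hy hz

end SecondDifference

theorem ne_zero_of_norm_eq_one {E : Type*} [NormedAddCommGroup E] {x : E} (hx : ‖x‖ = 1) : x ≠ 0 :=
  norm_ne_zero_iff.1 (by rw [hx]; exact one_ne_zero)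

/-! ### The infimum of `p (A - T z)` over the sphere. -/

section InfConvolution

variable {V Q : Type*} [NormedAddCommGroup V] [InnerProductSpace ℝ V] [NormedAddCommGroup Q]

/-- The infimum of `p (A - T z)` over the unit sphere. -/
noncomputable def infDistSphere (p : Q → ℝ) (T : V → Q) (A : Q) : ℝ :=
  ⨅ z : Metric.sphere (0 : V) 1, p (A - T z.1)

theorem le_infDistSphere [Nontrivial V] {p : Q → ℝ} {T : V → Q} {A : Q} {c : ℝ}
    (hc : ∀ z : V, ‖z‖ = 1 → c ≤ p (A - T z)) : c ≤ infDistSphere p T A :=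
  have : Nonempty (Metric.sphere (0 : V) 1) :=
    (NormedSpace.sphere_nonempty.2 zero_le_one).to_subtype
  le_ciInf fun z => hc z.1 (mem_sphere_zero_iff_norm.1 z.2)

theorem exists_lt_infDistSphere_add [Nontrivial V] {p : Q → ℝ} {T : V → Q} (A : Q) {s : ℝ} (hs : 0 < s) :
    ∃ z : V, ‖z‖ = 1 ∧ p (A - T z) < infDistSphere p T A + s := by
  by_contra! hc
  have := le_infDistSphere (T := T) hc
  linarith

variable [NormedSpace ℝ Q]

/-- A sublinearly bounded function `p` and a map `T`, homogeneous of degree `0` and smooth away from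
the origin, such that `p` separates the values of `T` on the unit sphere quantitatively. -/
structure IsSeparating (p : Q → ℝ) (T : V → Q) (C : ℝ) : Prop where
  add_le : ∀ A B, p (A + B) ≤ p A + p B
  le_norm : ∀ A, p A ≤ C * ‖A‖
  smul : ∀ t : ℝ, 0 < t → ∀ x, x ≠ 0 → T (t • x) = T x
  smooth : ∀ x, x ≠ 0 → ContDiffAt ℝ ∞ T x
  sep : ∀ a b, ‖a‖ = 1 → ‖b‖ = 1 → ‖a - b‖ ≤ p (T a - T b)

namespace IsSeparating

variable {p : Q → ℝ} {T : V → Q} {C : ℝ}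

theorem map_normalize (h : IsSeparating p T C) {x : V} (hx : x ≠ 0) : T (‖x‖⁻¹ • x) = T x :=
  h.smul _ (inv_pos.2 (norm_pos_iff.2 hx)) x hx

theorem map_zero (h : IsSeparating p T C) : p 0 = 0 := by
  have h1 := h.add_le 0 0
  have h2 := h.le_norm 0
  rw [add_zero] at h1
  rw [norm_zero, mul_zero] at h2
  linarith

theorem bddBelow (h : IsSeparating p T C) (A : Q) :
    BddBelow (Set.range fun z : Metric.sphere (0 : V) 1 => p (A - T z.1)) := by
  rcases isEmpty_or_nonempty (Metric.sphere (0 : V) 1) with he | ⟨⟨y, hy⟩⟩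
  · rw [Set.range_eq_empty]
    exact bddBelow_empty
  -- For any `y` on the sphere, `0 ≤ p (T y - T z) ≤ p (T y - A) + p (A - T z)`.
  refine ⟨-p (T y - A), ?_⟩
  rintro _ ⟨z, rfl⟩
  have h1 := h.add_le (T y - A) (A - T z.1)
  have h2 := h.sep y z.1 (mem_sphere_zero_iff_norm.1 hy) (mem_sphere_zero_iff_norm.1 z.2)
  rw [sub_add_sub_cancel] at h1
  have := norm_nonneg (y - z.1)
  change _ ≤ p (A - T z.1)
  linarith

theorem infDistSphere_le (h : IsSeparating p T C) (A : Q) {x : V} (hx : x ≠ 0) :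
    infDistSphere p T A ≤ p (A - T x) := by
  rw [← h.map_normalize hx]
  exact ciInf_le (h.bddBelow A) ⟨‖x‖⁻¹ • x, by simp [norm_smul, hx]⟩

theorem infDistSphere_add_le [Nontrivial V] (h : IsSeparating p T C) {A D : Q} {b : ℝ}
    (hD : ∀ B, p (B + D) ≤ p B + b) : infDistSphere p T (A + D) ≤ infDistSphere p T A + b := by
  rw [← sub_le_iff_le_add]
  refine le_infDistSphere fun z hz => ?_
  have h1 := hD (A - T z)
  have h2 := h.infDistSphere_le (A + D) (norm_ne_zero_iff.1 (by rw [hz]; norm_num) : z ≠ 0)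
  rw [sub_add_eq_add_sub] at h1
  linarith

theorem le_infDistSphere_add [Nontrivial V] (h : IsSeparating p T C) {A D : Q} {a : ℝ}
    (hD : ∀ B, p B + a ≤ p (B + D)) : infDistSphere p T A + a ≤ infDistSphere p T (A + D) := by
  refine le_infDistSphere fun z hz => ?_
  have h1 := hD (A - T z)
  have h2 := h.infDistSphere_le A (norm_ne_zero_iff.1 (by rw [hz]; norm_num) : z ≠ 0)
  rw [sub_add_eq_add_sub] at h1
  linarith

theorem infDistSphere_le_add [Nontrivial V] (h : IsSeparating p T C) (A B : Q) :
    infDistSphere p T A ≤ infDistSphere p T B + C * ‖A - B‖ := by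
  have := h.infDistSphere_add_le (A := B) (D := A - B) (b := C * ‖A - B‖) fun D =>
    (h.add_le _ _).trans (add_le_add le_rfl (h.le_norm _))
  rwa [add_sub_cancel] at this

theorem continuous_infDistSphere [Nontrivial V] (h : IsSeparating p T C) :
    Continuous (infDistSphere p T) := by
  refine continuous_iff_continuousAt.2 fun B => ?_
  have h0 : Tendsto (fun A => C * ‖A - B‖) (𝓝 B) (𝓝 0) := by
    have : Continuous fun A => C * ‖A - B‖ := by fun_prop
    simpa using this.tendsto B
  refine (tendsto_iff_of_dist (f₁ := fun _ => infDistSphere p T B) ?_).1 tendsto_const_nhds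
  refine squeeze_zero (fun _ => dist_nonneg) (fun A => ?_) h0
  rw [Real.dist_eq, abs_le]
  have h1 := h.infDistSphere_le_add A B
  have h2 := h.infDistSphere_le_add B A
  rw [norm_sub_rev] at h2
  constructor <;> linarith

theorem infDistSphere_map [Nontrivial V] (h : IsSeparating p T C) {x : V} (hx : x ≠ 0) :
    infDistSphere p T (T x) = 0 := by
  refine le_antisymm ?_ (le_infDistSphere fun z hz => ?_)
  · have := h.infDistSphere_le (T x) hx
    rwa [sub_self, h.map_zero] at this
  · rw [← h.map_normalize hx]
    exact (norm_nonneg _).trans (h.sep _ z (by simp [norm_smul, hx]) hz)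

theorem abs_infDistSphere_le [Nontrivial V] (h : IsSeparating p T C) {x : V} (hx : x ≠ 0) (E : Q) :
    |infDistSphere p T (T x + E)| ≤ C * ‖E‖ := by
  have h1 := h.infDistSphere_le_add (T x + E) (T x)
  have h2 := h.infDistSphere_le_add (T x) (T x + E)
  rw [h.infDistSphere_map hx] at h1 h2
  simp only [add_sub_cancel_left, sub_add_cancel_left, norm_neg] at h1 h2
  rw [abs_le]
  constructor <;> linarith

theorem norm_sub_le_mul (h : IsSeparating p T C) {x z : V} (hx : x ≠ 0) (hz : ‖z‖ = ‖x‖) :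
    ‖x - z‖ ≤ ‖x‖ * p (T x - T z) := by
  have hx0 : 0 < ‖x‖ := norm_pos_iff.2 hx
  have hz0 : z ≠ 0 := norm_pos_iff.1 (hz ▸ hx0)
  have h1 := h.sep (‖x‖⁻¹ • x) (‖z‖⁻¹ • z) (by simp [norm_smul, hx]) (by simp [norm_smul, hz0])
  rw [h.map_normalize hx, h.map_normalize hz0, hz, ← smul_sub, norm_smul, norm_inv, norm_norm,
    inv_mul_le_iff₀ hx0] at h1
  exact h1

/-- The factor `‖E‖` is the point: it makes the mollified function nearly constant along the image
of `T`. A near-minimiser `z` for `T x + E` lies within `O(‖E‖)` of `x` by separation; its translate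
`z + (y - x)` competes for `T y + E`, at the cost of a second difference of `T`. -/
theorem exists_infDistSphere_translate_le [Nontrivial V] [FiniteDimensional ℝ V]
    (h : IsSeparating p T C) (hC : 0 < C) :
    ∃ K, 0 ≤ K ∧ ∃ r > 0, ∀ x y E, 1 / 2 ≤ ‖x‖ → ‖x‖ ≤ 2 → ‖y - x‖ < r → ‖E‖ ≤ r →
      infDistSphere p T (T y + E) ≤ infDistSphere p T (T x + E) + K * ‖y - x‖ * ‖E‖ := by
  obtain ⟨M, hM0, hM⟩ := exists_norm_second_difference_le h.smooth
  refine ⟨4 * C ^ 2 * M, by positivity, min (1 / 8) (1 / (64 * C)), by positivity,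
    fun x y E hx1 hx2 hy hE => ?_⟩
  have hx : x ≠ 0 := norm_pos_iff.1 (by linarith)
  have hy8 : ‖y - x‖ < 1 / 8 := hy.trans_le (min_le_left _ _)
  have hE8 : C * ‖E‖ ≤ 1 / 64 := by
    have := hE.trans (min_le_right _ _)
    rw [le_div_iff₀ (by positivity)] at this
    linarith
  have key : ∀ s : ℝ, 0 < s → s < 1 / 64 → infDistSphere p T (T y + E) ≤
      infDistSphere p T (T x + E) + s + C * (M * ‖y - x‖ * (4 * (C * ‖E‖) + 2 * s)) := by
    intro s hs hs'
    obtain ⟨z₀, hz₀, hlt⟩ := exists_lt_infDistSphere_add (p := p) (T := T) (T x + E) hs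
    have hz₀0 : z₀ ≠ 0 := norm_ne_zero_iff.1 (by rw [hz₀]; norm_num)
    -- Homogeneity of degree zero allows the near-minimiser to be rescaled to the sphere through
    -- `x`, where `norm_sub_le_mul` measures its distance to `x`.
    obtain ⟨z, hz, hTz⟩ : ∃ z : V, ‖z‖ = ‖x‖ ∧ T z = T z₀ :=
      ⟨‖x‖ • z₀, by simp [norm_smul, hz₀], h.smul _ (norm_pos_iff.2 hx) _ hz₀0⟩
    rw [← hTz] at hlt
    have h1 : ‖x - z‖ ≤ 4 * (C * ‖E‖) + 2 * s := by
      have a1 := h.norm_sub_le_mul hx hz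
      have a2 := h.add_le (T x + E - T z) (-E)
      have a3 := h.le_norm (-E)
      have a4 := (abs_le.1 (h.abs_infDistSphere_le hx E)).2
      rw [show T x + E - T z + -E = T x - T z by abel] at a2
      rw [norm_neg] at a3
      have a5 : p (T x - T z) ≤ 2 * (C * ‖E‖) + s := by linarith
      have a6 : 0 ≤ 2 * (C * ‖E‖) + s := by positivity
      nlinarith [norm_nonneg x]
    have hz8 : ‖z - x‖ < 1 / 8 := by
      rw [norm_sub_rev]
      linarith
    have h2 := hM x y z hx1 hx2 hy8 hz8
    have hzv : z + (y - x) ≠ 0 := by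
      refine norm_pos_iff.1 ?_
      have : ‖z‖ ≤ ‖z + (y - x)‖ + ‖y - x‖ := by
        simpa using _root_.norm_sub_le (z + (y - x)) (y - x)
      linarith
    have h3 := h.infDistSphere_le (T y + E) hzv
    have h4 := h.add_le (T x + E - T z) ((T y - T x) - (T (z + (y - x)) - T z))
    rw [show T x + E - T z + ((T y - T x) - (T (z + (y - x)) - T z))
      = T y + E - T (z + (y - x)) by abel] at h4
    have h5 := h.le_norm ((T y - T x) - (T (z + (y - x)) - T z))
    have h6 := mul_le_mul_of_nonneg_left
      (h2.trans (mul_le_mul_of_nonneg_left h1 (by positivity))) hC.le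
    linarith
  have hlim : Tendsto (fun s : ℝ => infDistSphere p T (T x + E) + s
      + C * (M * ‖y - x‖ * (4 * (C * ‖E‖) + 2 * s))) (𝓝[>] 0)
      (𝓝 (infDistSphere p T (T x + E) + 4 * C ^ 2 * M * ‖y - x‖ * ‖E‖)) := by
    have : Continuous (fun s : ℝ => infDistSphere p T (T x + E) + s
      + C * (M * ‖y - x‖ * (4 * (C * ‖E‖) + 2 * s))) := by fun_prop
    have h0 := (this.tendsto 0).mono_left (nhdsWithin_le_nhds (s := Set.Ioi 0))
    convert h0 using 2
    ring
  refine ge_of_tendsto hlim ?_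
  filter_upwards [Ioo_mem_nhdsGT (show (0 : ℝ) < 1 / 64 by norm_num)] with s hs
  exact key s hs.1 hs.2

end IsSeparating

end InfConvolution

/-! ### Mollification. -/

section Mollify

/-- Averaging against a nonnegative weight of mass one supported in the `ε`-ball preserves
inequalities that hold for all shifts `E` in that ball. -/
theorem exists_contDiff_mollification {Q : Type*} [NormedAddCommGroup Q] [NormedSpace ℝ Q]
    [FiniteDimensional ℝ Q] {f : Q → ℝ} (hf : Continuous f) {ε : ℝ} (hε : 0 < ε) :
    ∃ g : Q → ℝ, ContDiff ℝ ∞ g ∧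
      (∀ A B c, (∀ E, ‖E‖ ≤ ε → f (A + E) ≤ f (B + E) + c) → g A ≤ g B + c) ∧
      ∀ A c, (∀ E, ‖E‖ ≤ ε → |f (A + E)| ≤ c) → |g A| ≤ c := by
  let _ : MeasurableSpace Q := borel Q
  have : BorelSpace Q := ⟨rfl⟩
  let μ : MeasureTheory.Measure Q := MeasureTheory.Measure.addHaar
  let φ : ContDiffBump (0 : Q) := ⟨ε / 2, ε, by linarith, by linarith⟩
  let g : Q → ℝ := fun A => ∫ t, φ.normed μ t * f (A - t) ∂μ
  have hφ : ContDiff ℝ ∞ (φ.normed μ) := φ.contDiff_normed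
  have hsupp : ∀ t, ε < ‖t‖ → φ.normed μ t = 0 := fun t ht => by
    have : t ∉ Function.support (φ.normed μ) := by
      rw [φ.support_normed_eq, mem_ball_zero_iff]
      exact not_lt.2 ht.le
    simpa using this
  have hint : ∀ u : Q → ℝ, Continuous u →
      MeasureTheory.Integrable (fun t => φ.normed μ t * u t) μ := fun u hu =>
    (hφ.continuous.mul hu).integrable_of_hasCompactSupport φ.hasCompactSupport_normed.mul_right
  have mono : ∀ u v : Q → ℝ, Continuous u → Continuous v → (∀ t, ‖t‖ ≤ ε → u t ≤ v t) →
      ∫ t, φ.normed μ t * u t ∂μ ≤ ∫ t, φ.normed μ t * v t ∂μ := fun u v hu hv huv => by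
    refine MeasureTheory.integral_mono (hint u hu) (hint v hv) fun t => ?_
    rcases le_or_gt ‖t‖ ε with ht | ht
    · exact mul_le_mul_of_nonneg_left (huv t ht) (φ.nonneg_normed t)
    · simp [hsupp t ht]
  have hconst : ∀ c : ℝ, ∫ t, φ.normed μ t * c ∂μ = c := fun c => by
    rw [MeasureTheory.integral_mul_const, φ.integral_normed, one_mul]
  refine ⟨g, ?_, fun A B c h => ?_, fun A c h => abs_le.2 ⟨?_, ?_⟩⟩
  · have := φ.hasCompactSupport_normed.contDiff_convolution_left (μ := μ)
      (ContinuousLinearMap.mul ℝ ℝ) hφ hf.locallyIntegrable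
    exact this
  · have h1 := mono (fun t => f (A - t)) (fun t => f (B - t) + c) (by fun_prop) (by fun_prop)
      fun t ht => by
        have := h (-t) (by rwa [norm_neg])
        simpa only [← sub_eq_add_neg] using this
    have h2 : ∫ t, φ.normed μ t * (f (B - t) + c) ∂μ = g B + c := by
      simp only [mul_add]
      rw [MeasureTheory.integral_add (hint _ (by fun_prop)) (hint _ (by fun_prop)), hconst]
    exact h1.trans h2.le
  · rw [← hconst (-c)]
    refine mono (fun _ => -c) (fun t => f (A - t)) (by fun_prop) (by fun_prop) fun t ht => ?_
    have := h (-t) (by rwa [norm_neg])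
    rw [← sub_eq_add_neg] at this
    exact (abs_le.1 this).1
  · rw [← hconst c]
    refine mono (fun t => f (A - t)) (fun _ => c) (by fun_prop) (by fun_prop) fun t ht => ?_
    have := h (-t) (by rwa [norm_neg])
    rw [← sub_eq_add_neg] at this
    exact (abs_le.1 this).2

theorem le_apply_of_hasFDerivAt_of_increment {Q : Type*} [NormedAddCommGroup Q] [NormedSpace ℝ Q] {g : Q → ℝ}
    {A D : Q} {g' : Q →L[ℝ] ℝ} (hg : HasFDerivAt g g' A) {a : ℝ}
    (ha : ∀ s : ℝ, 0 ≤ s → g A + s * a ≤ g (A + s • D)) : a ≤ g' D := by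
  have h1 : HasDerivAt (fun s : ℝ => g (A + s • D)) (g' D) 0 := hg.hasLineDerivAt D
  refine ge_of_tendsto h1.tendsto_slope_zero_right ?_
  filter_upwards [self_mem_nhdsWithin] with s hs
  have hs0 : 0 < s := hs
  have := ha s hs0.le
  simp only [zero_add, zero_smul, add_zero, smul_eq_mul]
  rw [inv_mul_eq_div, le_div_iff₀ hs0]
  linarith

end Mollify

/-! ### A smooth left inverse of `T` on the sphere. -/

section LeftInverse

variable {V Q : Type*} [NormedAddCommGroup V] [InnerProductSpace ℝ V] [NormedAddCommGroup Q]
  [NormedSpace ℝ Q] {p : Q → ℝ} {T : V → Q} {C : ℝ}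

namespace IsSeparating

/-- Infinitesimal separation: `T` is an immersion of the sphere. It follows by comparing `x` with
the normalisation of `x + s • v` and letting `s → 0`. -/
theorem norm_le_fderiv (h : IsSeparating p T C) (hC : 0 < C) {x v : V} (hx : ‖x‖ = 1)
    (hv : inner ℝ x v = 0) : ‖v‖ ≤ C * ‖fderiv ℝ T x v‖ := by
  have hx0 : x ≠ 0 := ne_zero_of_norm_eq_one hx
  have hd : HasDerivAt (fun s : ℝ => T (x + s • v)) (fderiv ℝ T x v) 0 :=
    (((h.smooth x hx0).differentiableAt (by norm_cast)).hasFDerivAt).hasLineDerivAt v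
  have hlim : Tendsto (fun s : ℝ => ‖x + s • v‖ * (C * ‖s⁻¹ • (T (x + s • v) - T x)‖)) (𝓝[>] 0)
      (𝓝 (‖x + (0 : ℝ) • v‖ * (C * ‖fderiv ℝ T x v‖))) := by
    have h1 : Continuous fun s : ℝ => ‖x + s • v‖ := by fun_prop
    refine ((h1.tendsto 0).mono_left nhdsWithin_le_nhds).mul (Tendsto.const_mul C ?_)
    have := hd.tendsto_slope_zero_right.norm
    simpa only [zero_add, zero_smul, add_zero] using this
  rw [zero_smul, add_zero, hx, one_mul] at hlim
  refine ge_of_tendsto hlim ?_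
  filter_upwards [self_mem_nhdsWithin] with s hs
  have hs0 : 0 < s := hs
  set y := x + s • v with hy
  have hy2 : ‖y‖ ^ 2 = 1 + s ^ 2 * ‖v‖ ^ 2 := by
    rw [hy, norm_add_sq_real, hx, real_inner_smul_right, hv, norm_smul, Real.norm_of_nonneg hs0.le]
    ring
  have hy0 : 0 < ‖y‖ := by
    rcases (norm_nonneg y).eq_or_lt with h0 | h0
    · rw [← h0] at hy2
      nlinarith [sq_nonneg (s * ‖v‖)]
    · exact h0
  have h1 := h.sep _ _ (by simp [norm_smul, hy0.ne'] : ‖‖y‖⁻¹ • y‖ = 1) hx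
  rw [h.map_normalize (norm_pos_iff.1 hy0)] at h1
  have h2 : ‖y‖⁻¹ • y - x = ‖y‖⁻¹ • (s • v + (1 - ‖y‖) • x) := by
    have : s • v + (1 - ‖y‖) • x = y - ‖y‖ • x := by
      rw [show s • v = y - x by rw [hy]; abel, sub_smul, one_smul]
      abel
    rw [this, smul_sub, inv_smul_smul₀ hy0.ne']
  have h3 : s * ‖v‖ ≤ ‖s • v + (1 - ‖y‖) • x‖ := by
    refine abs_le_of_sq_le_sq' ?_ (norm_nonneg _) |>.2
    rw [norm_add_sq_real, norm_smul, Real.norm_of_nonneg hs0.le, real_inner_smul_left,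
      real_inner_smul_right, real_inner_comm, hv]
    nlinarith [sq_nonneg ‖(1 - ‖y‖) • x‖]
  rw [h2, norm_smul, norm_inv, norm_norm, inv_mul_le_iff₀ hy0] at h1
  have h4 := h.le_norm (T y - T x)
  have h5 := mul_le_mul_of_nonneg_left h4 hy0.le
  rw [norm_smul, norm_inv, Real.norm_of_nonneg hs0.le]
  have h6 : ‖y‖ * (C * (s⁻¹ * ‖T y - T x‖)) = ‖y‖ * (C * ‖T y - T x‖) / s := by
    field_simp
  rw [h6, le_div_iff₀ hs0]
  linarith

/-- Adjoining the radial function `(‖x‖² - 1) / 2` to `T` gives an injective derivative at `x₀`.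
Composing with a linear left inverse `S` gives `G` with derivative the identity, and on the sphere
`G x = S (T x, 0)` depends on `T x` only; the inverse function theorem gives `G⁻¹ (S (·, 0))`. -/
theorem exists_local_leftInverse [FiniteDimensional ℝ V] [FiniteDimensional ℝ Q]
    (h : IsSeparating p T C) (hC : 0 < C) {x₀ : V} (hx₀ : ‖x₀‖ = 1) :
    ∃ U ∈ 𝓝 (T x₀), ∃ g : Q → V, ContDiffOn ℝ ∞ g U ∧ ∀ x, ‖x‖ = 1 → T x ∈ U → g (T x) = x := by
  have hx0 : x₀ ≠ 0 := ne_zero_of_norm_eq_one hx₀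
  let B : V →L[ℝ] Q × ℝ := (fderiv ℝ T x₀).prod (innerSL ℝ x₀)
  have hB : LinearMap.ker (B : V →ₗ[ℝ] Q × ℝ) = ⊥ := by
    refine LinearMap.ker_eq_bot'.2 fun v hv => ?_
    have h1 : fderiv ℝ T x₀ v = 0 := congrArg Prod.fst hv
    have h2 : inner ℝ x₀ v = 0 := congrArg Prod.snd hv
    have := h.norm_le_fderiv hC hx₀ h2
    rw [h1, norm_zero, mul_zero] at this
    exact norm_le_zero_iff.1 this
  obtain ⟨S₀, hS₀⟩ := LinearMap.exists_leftInverse_of_injective _ hB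
  let S : Q × ℝ →L[ℝ] V := S₀.toContinuousLinearMap
  have hS : ∀ v, S (B v) = v := fun v => LinearMap.congr_fun hS₀ v
  let G : V → V := fun x => S (T x, (‖x‖ ^ 2 - 1) / 2)
  have hG : ∀ x, x ≠ 0 → ContDiffAt ℝ ∞ G x := fun x hx =>
    S.contDiff.contDiffAt.comp x ((h.smooth x hx).prodMk
      (((contDiff_norm_sq ℝ).contDiffAt.sub contDiffAt_const).div_const 2))
  have hGd : HasFDerivAt G ((ContinuousLinearEquiv.refl ℝ V : V ≃L[ℝ] V) : V →L[ℝ] V) x₀ := by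
    have h1 := ((h.smooth x₀ hx0).differentiableAt (by norm_cast)).hasFDerivAt
    have h2 : HasFDerivAt (fun x : V => (‖x‖ ^ 2 - 1) / 2) (innerSL ℝ x₀) x₀ := by
      have := ((hasStrictFDerivAt_norm_sq x₀).hasFDerivAt.sub_const 1).const_mul (1 / 2 : ℝ)
      refine (this.congr_fderiv ?_).congr_of_eventuallyEq (.of_forall fun y => ?_)
      · ext v
        simp
      · ring
    have h3 := S.hasFDerivAt.comp x₀ (h1.prodMk h2)
    exact h3.congr_fderiv (ContinuousLinearMap.ext hS)
  let e := (hG x₀ hx0).toOpenPartialHomeomorph G hGd (by norm_cast)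
  have he : ∀ x, e x = G x := fun x => rfl
  have hes : x₀ ∈ e.source := (hG x₀ hx0).mem_toOpenPartialHomeomorph_source hGd (by norm_cast)
  have hG0 : G x₀ = S (T x₀, 0) := by simp [G, hx₀]
  have hmap : ∀ x, ‖x‖ = 1 → G x = S (T x, 0) := fun x hx => by simp [G, hx]
  -- Smoothness of the inverse is needed on a whole neighbourhood, hence invertibility of the
  -- derivative at each nearby point.
  let W : Set V := {x | x ≠ 0 ∧ ∃ e' : V ≃L[ℝ] V, (e' : V →L[ℝ] V) = fderiv ℝ G x}
  have hW : W ∈ 𝓝 x₀ := by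
    have h1 : ContinuousAt (fderiv ℝ G) x₀ :=
      ((hG x₀ hx0).fderiv_right (m := ∞) (by norm_cast)).continuousAt
    have h2 : fderiv ℝ G x₀ = ((ContinuousLinearEquiv.refl ℝ V : V ≃L[ℝ] V) : V →L[ℝ] V) :=
      hGd.fderiv
    have h3 : Set.range ((↑) : (V ≃L[ℝ] V) → V →L[ℝ] V) ∈ 𝓝 (fderiv ℝ G x₀) := by
      rw [h2]
      exact ContinuousLinearEquiv.nhds _
    exact (eventually_ne_nhds hx0).and (h1 h3)
  have hN : e.target ∩ e.symm ⁻¹' W ∈ 𝓝 (G x₀) := by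
    refine inter_mem (e.open_target.mem_nhds (e.map_source hes)) ?_
    have : Tendsto e.symm (𝓝 (G x₀)) (𝓝 x₀) := by
      have := e.continuousAt_symm (e.map_source hes)
      rwa [ContinuousAt, e.left_inv hes] at this
    exact this hW
  obtain ⟨δ, hδ, hball⟩ := Metric.mem_nhds_iff.1 (e.open_source.mem_nhds hes)
  have hcont : Continuous fun A : Q => S (A, 0) := by fun_prop
  have hA : {A : Q | S (A, 0) ∈ e.target ∩ e.symm ⁻¹' W} ∈ 𝓝 (T x₀) :=
    hcont.continuousAt.preimage_mem_nhds (by rw [← hG0]; exact hN)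
  refine ⟨_, inter_mem hA (Metric.ball_mem_nhds (T x₀) (div_pos hδ hC)),
    fun A => e.symm (S (A, 0)), ?_, fun x hx hxU => ?_⟩
  · rintro A ⟨⟨hA1, hA2, e', he'⟩, -⟩
    have hd : HasFDerivAt e (e' : V →L[ℝ] V) (e.symm (S (A, 0))) := by
      rw [he']
      exact ((hG _ hA2).differentiableAt (by norm_cast)).hasFDerivAt
    have h1 := e.contDiffAt_symm hA1 hd (hG _ hA2)
    have h2 : ContDiff ℝ ∞ fun A : Q => S (A, 0) := S.contDiff.comp (contDiff_id.prodMk contDiff_const)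
    exact (h1.comp A h2.contDiffAt).contDiffWithinAt
  · change e.symm (S (T x, 0)) = x
    rw [← hmap x hx, ← he]
    refine e.left_inv (hball ?_)
    rw [mem_ball_iff_norm]
    -- Separation forces `x` close to `x₀` once `T x` is close to `T x₀`, so no distant sheet of the
    -- image interferes.
    have h1 := (h.sep x x₀ hx hx₀).trans (h.le_norm _)
    have h2 := mem_ball_iff_norm.1 hxU.2
    rw [lt_div_iff₀ hC] at h2
    linarith

theorem continuousOn_sphere (h : IsSeparating p T C) : ContinuousOn T (Metric.sphere 0 1) :=
  fun x hx => (h.smooth x (ne_zero_of_norm_eq_one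
    (mem_sphere_zero_iff_norm.1 hx))).continuousAt.continuousWithinAt

/-- The requirement on the value at `A` is convex: it prescribes a point on the image of the sphere
and nothing off it. Local solutions therefore glue by a partition of unity. -/
theorem exists_leftInverse [FiniteDimensional ℝ V] [FiniteDimensional ℝ Q]
    (h : IsSeparating p T C) (hC : 0 < C) :
    ∃ R : Q → V, ContDiff ℝ ∞ R ∧ ∀ x, ‖x‖ = 1 → R (T x) = x := by
  let t : Q → Set V := fun A => {y | ∀ x, ‖x‖ = 1 → T x = A → y = x}
  have ht : ∀ A, Convex ℝ (t A) := fun A y hy z hz a b _ _ hab x hx hA => by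
    rw [hy x hx hA, hz x hx hA, ← add_smul, hab, one_smul]
  have hloc : ∀ A : Q, ∃ U ∈ 𝓝 A, ∃ g : Q → V, ContMDiffOn 𝓘(ℝ, Q) 𝓘(ℝ, V) ∞ g U ∧
      ∀ B ∈ U, g B ∈ t B := fun A => by
    by_cases hA : A ∈ T '' Metric.sphere 0 1
    · obtain ⟨x₀, hx₀, rfl⟩ := hA
      obtain ⟨U, hU, g, hg, hgU⟩ :=
        h.exists_local_leftInverse hC (mem_sphere_zero_iff_norm.1 hx₀)
      refine ⟨U, hU, g, hg.contMDiffOn, fun B hB x hx hxB => ?_⟩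
      subst hxB
      exact hgU x hx hB
    · have hcl : IsClosed (T '' Metric.sphere 0 1) :=
        ((isCompact_sphere 0 1).image_of_continuousOn h.continuousOn_sphere).isClosed
      refine ⟨_, hcl.isOpen_compl.mem_nhds hA, fun _ => 0, contMDiffOn_const, fun B hB x hx hxB => ?_⟩
      exact absurd ⟨x, mem_sphere_zero_iff_norm.2 hx, hxB⟩ hB
  obtain ⟨R, hR⟩ := exists_contMDiffMap_forall_mem_convex_of_local 𝓘(ℝ, Q) ht hloc
  exact ⟨R, R.contMDiff.contDiff, fun x hx => hR (T x) x hx rfl⟩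

end IsSeparating

end LeftInverse

/-! ### Restoring the zero set after mollification. -/

section Correction

variable {V Q : Type*} [NormedAddCommGroup V] [InnerProductSpace ℝ V] [NormedAddCommGroup Q]
  [NormedSpace ℝ Q] {p : Q → ℝ} {T : V → Q} {C : ℝ}

theorem exists_cutoff [FiniteDimensional ℝ Q] {R : Q → V} (hR : ContDiff ℝ ∞ R) {S : Set Q}
    (hS : IsCompact S) (hRS : ∀ A ∈ S, ‖R A‖ = 1) :
    ∃ (χ : Q → ℝ) (D : Set Q), ContDiff ℝ ∞ χ ∧ IsCompact D ∧ (∀ A, |χ A| ≤ 1) ∧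
      (∀ A ∈ S, χ A = 1) ∧ (∀ A ∉ D, χ A = 0) ∧ ∀ A ∈ D, 1 / 2 < ‖R A‖ ∧ ‖R A‖ < 2 := by
  obtain ⟨M, hM⟩ := hS.exists_bound_of_continuousOn (f := fun A => A) continuousOn_id
  let φ : ContDiffBump (0 : Q) := ⟨max M 1, max M 1 + 1, by positivity, by linarith⟩
  let ψ : ContDiffBump (1 : ℝ) := ⟨1 / 4, 1 / 2, by norm_num, by norm_num⟩
  have hn : ContDiff ℝ ∞ fun A => ‖R A‖ ^ 2 := hR.norm_sq ℝ
  refine ⟨fun A => φ A * ψ (‖R A‖ ^ 2),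
    Metric.closedBall 0 (max M 1 + 1) ∩ (fun A => ‖R A‖ ^ 2) ⁻¹' Metric.closedBall 1 (1 / 2),
    φ.contDiff.mul (ψ.contDiff.comp hn),
    (isCompact_closedBall 0 _).inter_right (Metric.isClosed_closedBall.preimage hn.continuous),
    fun A => ?_, fun A hA => ?_, fun A hA => ?_, fun A hA => ?_⟩
  · rw [abs_of_nonneg (mul_nonneg φ.nonneg ψ.nonneg)]
    exact mul_le_one₀ φ.le_one ψ.nonneg ψ.le_one
  · have h1 : φ A = 1 := φ.one_of_mem_closedBall
      (mem_closedBall_zero_iff.2 ((hM A hA).trans (le_max_left _ _)))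
    have h2 : ψ (‖R A‖ ^ 2) = 1 := ψ.one_of_mem_closedBall (by
      rw [hRS A hA, one_pow]
      exact Metric.mem_closedBall_self (by norm_num))
    simp only [h1, h2, one_mul]
  · rcases not_and_or.1 hA with h | h
    · have : φ A = 0 := φ.zero_of_le_dist (not_le.1 h).le
      simp only [this, zero_mul]
    · have : ψ (‖R A‖ ^ 2) = 0 := ψ.zero_of_le_dist (not_le.1 h).le
      simp only [this, mul_zero]
  · have h : |‖R A‖ ^ 2 - 1| ≤ 1 / 2 := hA.2
    rw [abs_le] at h
    have := norm_nonneg (R A)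
    constructor <;> nlinarith

theorem norm_fderiv_mul_comp_le {χ : Q → ℝ} {R : Q → V} {H : V → ℝ} {A : Q} {c₀ c₁ c₂ : ℝ}
    (hχ : DifferentiableAt ℝ χ A) (hR : DifferentiableAt ℝ R A) (hH : DifferentiableAt ℝ H (R A))
    (h1 : |χ A| ≤ 1) (h0 : |H (R A)| ≤ c₀) (hd : ‖fderiv ℝ H (R A)‖ ≤ c₁)
    (hc : ‖fderiv ℝ χ A‖ ≤ c₂) (hcR : ‖fderiv ℝ R A‖ ≤ c₂) :
    ‖fderiv ℝ (fun B => χ B * H (R B)) A‖ ≤ (c₀ + c₁) * c₂ := by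
  have hf : HasFDerivAt (fun B => χ B * H (R B))
      (χ A • (fderiv ℝ H (R A)).comp (fderiv ℝ R A) + H (R A) • fderiv ℝ χ A) A :=
    hχ.hasFDerivAt.mul (hH.hasFDerivAt.comp A hR.hasFDerivAt)
  rw [hf.fderiv]
  have a1 := (fderiv ℝ H (R A)).opNorm_comp_le (fderiv ℝ R A)
  have a2 := mul_le_mul hd hcR (norm_nonneg _) ((norm_nonneg _).trans hd)
  have a3 := mul_le_mul h0 hc (norm_nonneg _) ((abs_nonneg _).trans h0)
  have a4 := mul_le_mul h1 (a1.trans a2) (norm_nonneg _) zero_le_one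
  refine (norm_add_le _ _).trans ?_
  rw [norm_smul, norm_smul, Real.norm_eq_abs, Real.norm_eq_abs]
  linarith

namespace IsSeparating

theorem exists_smooth_vanishing [FiniteDimensional ℝ V] [Nontrivial V] [FiniteDimensional ℝ Q]
    (h : IsSeparating p T C) (hC : 0 < C) :
    ∃ F : Q → ℝ, ContDiff ℝ ∞ F ∧ (∀ x, x ≠ 0 → F (T x) = 0) ∧
      ∀ (A D : Q) (a b : ℝ), (∀ B, ∀ s : ℝ, 0 ≤ s → p B + s * a ≤ p (B + s • D)) →
        (∀ B, ∀ s : ℝ, 0 ≤ s → p (B + s • D) ≤ p B + s * b) →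
        a - ‖D‖ / 2 ≤ fderiv ℝ F A D ∧ fderiv ℝ F A D ≤ b + ‖D‖ / 2 := by
  obtain ⟨R, hR, hRT⟩ := h.exists_leftInverse hC
  have hS : IsCompact (T '' Metric.sphere 0 1) :=
    (isCompact_sphere 0 1).image_of_continuousOn h.continuousOn_sphere
  obtain ⟨χ, S, hχ, hScomp, hχ1, hχS, hχ0, hSR⟩ := exists_cutoff hR hS (by
    rintro _ ⟨x, hx, rfl⟩
    rw [hRT x (mem_sphere_zero_iff_norm.1 hx), mem_sphere_zero_iff_norm.1 hx])
  obtain ⟨m₁, hm₁⟩ := hScomp.exists_bound_of_continuousOn (f := fun A => fderiv ℝ χ A)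
    (hχ.continuous_fderiv (by norm_cast)).continuousOn
  obtain ⟨m₂, hm₂⟩ := hScomp.exists_bound_of_continuousOn (f := fun A => fderiv ℝ R A)
    (hR.continuous_fderiv (by norm_cast)).continuousOn
  set m := max (max m₁ m₂) 1 with hm
  have hm0 : 0 < m := lt_of_lt_of_le one_pos (le_max_right _ _)
  obtain ⟨K, hK, r, hr, htr⟩ := h.exists_infDistSphere_translate_le hC
  -- The bounds for `χ` and `R` in `m` do not depend on the mollification, so `ε` can be chosen
  -- after them to keep the derivative of the correction below `1 / 2`.
  set ε := min r (1 / (2 * (C + K) * m)) with hε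
  have hε0 : 0 < ε := by positivity
  have hεm : (C * ε + K * ε) * m ≤ 1 / 2 := by
    have : ε ≤ 1 / (2 * (C + K) * m) := min_le_right _ _
    rw [le_div_iff₀ (by positivity)] at this
    linarith
  obtain ⟨g, hg, hgle, hgabs⟩ := exists_contDiff_mollification h.continuous_infDistSphere hε0
  have hgT : ∀ x, x ≠ 0 → |g (T x)| ≤ C * ε := fun x hx => hgabs _ _ fun E hE =>
    (h.abs_infDistSphere_le hx E).trans (mul_le_mul_of_nonneg_left hE hC.le)
  have hgT' : ∀ x y : V, 1 / 2 ≤ ‖x‖ → ‖x‖ ≤ 2 → ‖y - x‖ < r →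
      g (T y) ≤ g (T x) + K * ε * ‖y - x‖ := fun x y hx1 hx2 hy => hgle _ _ _ fun E hE => by
    refine (htr x y E hx1 hx2 hy (hE.trans (min_le_left _ _))).trans (add_le_add le_rfl ?_)
    rw [mul_right_comm]
    exact mul_le_mul_of_nonneg_right (mul_le_mul_of_nonneg_left hE hK) (norm_nonneg _)
  have hgTs : ∀ x, x ≠ 0 → ContDiffAt ℝ ∞ (fun x => g (T x)) x := fun x hx =>
    hg.contDiffAt.comp x (h.smooth x hx)
  have hgTd : ∀ x : V, 1 / 2 < ‖x‖ → ‖x‖ < 2 → ‖fderiv ℝ (fun x => g (T x)) x‖ ≤ K * ε := by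
    intro x hx1 hx2
    refine norm_fderiv_le_of_lip' ℝ (by positivity) ?_
    have e1 : ∀ᶠ y in 𝓝 x, ‖y - x‖ < r := by
      have := Metric.ball_mem_nhds x hr
      filter_upwards [this] with y hy
      exact mem_ball_iff_norm.1 hy
    filter_upwards [e1, continuous_norm.continuousAt.eventually (lt_mem_nhds hx1),
      continuous_norm.continuousAt.eventually (gt_mem_nhds hx2)] with y hy hy1 hy2
    have a1 := hgT' x y hx1.le hx2.le hy
    have a2 := hgT' y x hy1.le hy2.le (by rwa [norm_sub_rev])
    rw [norm_sub_rev x y] at a2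
    rw [Real.norm_eq_abs, abs_le]
    constructor <;> linarith
  -- On the image of the sphere `χ = 1` and `T (R A) = A`, so `k` equals `g` there; elsewhere `χ`
  -- keeps `R A` away from the singularity of `T` at `0`.
  let k : Q → ℝ := fun A => χ A * g (T (R A))
  have hne : ∀ A ∈ S, R A ≠ 0 := fun A hA => norm_pos_iff.1 (by linarith [(hSR A hA).1])
  have hk0 : ∀ A ∉ S, k =ᶠ[𝓝 A] fun _ => 0 := fun A hA => by
    filter_upwards [hScomp.isClosed.isOpen_compl.mem_nhds hA] with B hB
    simp only [k, hχ0 B hB, zero_mul]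
  have hk : ContDiff ℝ ∞ k := contDiff_iff_contDiffAt.2 fun A => by
    by_cases hA : A ∈ S
    · exact hχ.contDiffAt.mul ((hgTs _ (hne A hA)).comp A hR.contDiffAt)
    · exact contDiffAt_const.congr_of_eventuallyEq (hk0 A hA)
  have hkd : ∀ A, ‖fderiv ℝ k A‖ ≤ 1 / 2 := fun A => by
    by_cases hA : A ∈ S
    · refine le_trans ?_ hεm
      exact norm_fderiv_mul_comp_le (H := fun x => g (T x)) (hχ.differentiable (by norm_cast) A)
        (hR.differentiable (by norm_cast) A) ((hgTs _ (hne A hA)).differentiableAt (by norm_cast))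
        (hχ1 A) (hgT _ (hne A hA)) (hgTd _ (hSR A hA).1 (hSR A hA).2)
        ((hm₁ A hA).trans ((le_max_left _ _).trans (le_max_left _ _)))
        ((hm₂ A hA).trans ((le_max_right _ _).trans (le_max_left _ _)))
    · rw [(hk0 A hA).fderiv_eq]
      simp
  refine ⟨fun A => g A - k A, hg.sub hk, fun x hx => ?_, fun A D a b ha hb => ?_⟩
  · have hx1 : ‖‖x‖⁻¹ • x‖ = 1 := by simp [norm_smul, hx]
    rw [← h.map_normalize hx]
    simp only [k]
    rw [hχS _ ⟨_, mem_sphere_zero_iff_norm.2 hx1, rfl⟩, hRT _ hx1, one_mul, sub_self]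
  · have hgd : HasFDerivAt g (fderiv ℝ g A) A := (hg.differentiable (by norm_cast) A).hasFDerivAt
    have hkd' : HasFDerivAt k (fderiv ℝ k A) A := (hk.differentiable (by norm_cast) A).hasFDerivAt
    have hF : fderiv ℝ (fun A => g A - k A) A D = fderiv ℝ g A D - fderiv ℝ k A D := by
      rw [(hgd.fun_sub hkd').fderiv]
      rfl
    have hkD : |fderiv ℝ k A D| ≤ ‖D‖ / 2 := by
      have := (fderiv ℝ k A).le_of_opNorm_le (hkd A) D
      rw [Real.norm_eq_abs] at this
      linarith
    have h1 : a ≤ fderiv ℝ g A D := le_apply_of_hasFDerivAt_of_increment hgd fun s hs => by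
      have := hgle A (A + s • D) (-(s * a)) fun E _ => by
        have := h.le_infDistSphere_add (A := A + E) (D := s • D) fun B => ha B s hs
        rw [add_right_comm] at this
        linarith
      linarith
    have h2 : -b ≤ (-fderiv ℝ g A) D := le_apply_of_hasFDerivAt_of_increment hgd.neg fun s hs => by
      have := hgle (A + s • D) A (s * b) fun E _ => by
        have := h.infDistSphere_add_le (A := A + E) (D := s • D) fun B => hb B s hs
        rwa [add_right_comm] at this
      simp only [Pi.neg_apply]
      linarith
    have h3 : (-fderiv ℝ g A) D = -fderiv ℝ g A D := rfl
    rw [abs_le] at hkD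
    rw [hF]
    constructor <;> linarith

end IsSeparating

end Correction

/-! ### Assembly. -/

theorem isSeparating_hessian_quaternionicW :
    IsSeparating (SymMat.extremal (2 * 10 ^ 5)) (hessian quaternionicW) (12 + 2 * 10 ^ 5) where
  add_le := SymMat.extremal_add_le (by norm_num)
  le_norm A := by simpa using SymMat.extremal_le (κ := 2 * 10 ^ 5) (by norm_num) A
  smul t ht x hx := hessian_quaternionicW_smul ht hx
  smooth x hx := contDiffAt_hessian (contDiffAt_quaternionicW hx)
  sep a b ha hb := norm_sub_le_extremal ha hb

theorem mainTheorem1 :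
    (∀ (t : ℝ) (x : EuclideanSpace ℝ (Fin 12)), 0 < t →
      quaternionicW (t • x) = t ^ 2 * quaternionicW x) ∧
    ∃ (F : SymMat 12 → ℝ) (Λ : ℝ),
      ContDiff ℝ ∞ F ∧ IsUniformlyElliptic F Λ ∧ Λ < 10 ^ 8 ∧
      IsViscositySolution F Set.univ quaternionicW ∧
      SatisfiesMaximumPrinciple F Set.univ quaternionicW := by
  refine ⟨fun t x ht => quaternionicW_smul t x ht, ?_⟩
  obtain ⟨F, hF, hF0, hFd⟩ :=
    isSeparating_hessian_quaternionicW.exists_smooth_vanishing (by norm_num)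
  -- The derivative on `rankOne ξ` lies between `1 / 2` and `1 + 2 * 10 ^ 5 + 1 / 2` times `‖ξ‖²`,
  -- so `10 ^ 6` leaves room.
  have hell : IsUniformlyElliptic F (10 ^ 6) := by
    refine ⟨by norm_num, hF.differentiable (by norm_cast), fun A ξ => ?_⟩
    -- Nonnegative multiples of a rank-one matrix are again rank-one, so the increment bounds of
    -- `SymMat.extremal` hold for every `s`.
    have hroot : ∀ s : ℝ, 0 ≤ s → s • rankOne ξ = rankOne (√s • ξ) ∧ ‖√s • ξ‖ ^ 2 = s * ‖ξ‖ ^ 2 :=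
      fun s hs => by
        rw [rankOne_smul, norm_smul, mul_pow, Real.norm_of_nonneg (Real.sqrt_nonneg s),
          Real.sq_sqrt hs]
        exact ⟨rfl, rfl⟩
    have := hFd A (rankOne ξ) (‖ξ‖ ^ 2) ((1 + 2 * 10 ^ 5) * ‖ξ‖ ^ 2)
      (fun B s hs => by
        rw [(hroot s hs).1, ← (hroot s hs).2]
        exact SymMat.le_extremal_add_rankOne (by norm_num) B _)
      (fun B s hs => by
        rw [(hroot s hs).1, mul_left_comm, ← (hroot s hs).2]
        exact SymMat.extremal_add_rankOne_le (by norm_num) B _)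
    rw [norm_rankOne] at this
    have h0 := sq_nonneg ‖ξ‖
    constructor <;> norm_num at this ⊢ <;> linarith
  have hv : IsViscositySolution F Set.univ quaternionicW :=
    isViscositySolution_of_homogeneous continuous_quaternionicW
      (fun t x ht => quaternionicW_smul t x ht)
      (fun x hx => (contDiffAt_quaternionicW hx).of_le (by norm_cast)) hell hF0
  exact ⟨F, 10 ^ 6, hF, hell, by norm_num, hv, hv.satisfiesMaximumPrinciple hell⟩
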